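/- Let $\mathbb D$ be the open unit disk and $\mathbb T$ the unit circle in $\mathbb C$, with normalized area measure $dA=\frac{dx\,dy}{\pi}$ on $\mathbb D$ and normalized arc length $ds=\frac{|dz|}{2\pi}$ on $\mathbb T$. For $\mu\in L^\infty(\mathbb D)$ let $P\mu(z)=\int_{\mathbb D}\frac{\mu(w)}{(1-z\bar w)^2}\,dA(w)$, $z\in\mathbb D$, be its Bergman projection. (a) If $\mu\in L^\infty(\mathbb D)$ with $\|\mu\|_{L^\infty(\mathbb D)}\le 1$ and $g=P\mu$, then for all $0<a<1$ and all $0<r<1$, $$\int_{\mathbb T}\exp\Big\{a\,\frac{r^4|g(r\zeta)|^2}{\log\frac{1}{1-r^2}}\Big\}\,ds(\zeta)\le 10\,(1-a)^{-3/2}.$$ (b) The function $\mu_0(z)=\frac{1-\bar z}{1-z}$ on $\mathbb D$ belongs to $L^\infty(\mathbb D)$ with $\|\mu_0\|_{L^\infty(\mathbb D)}=1$, and with $g_0=P\mu_0$, for every $1<a<+\infty$, $$\lim_{r\to1^-}\int_{\mathbb T}\exp\Big\{a\,\frac{r^4|g_0(r\zeta)|^2}{\log\frac{1}{1-r^2}}\Big\}\,ds(\zeta)=+\infty.$$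 (c) Let $\mathcal G=\{P\mu:\ \mu\in L^\infty(\mathbb D),\ \|\mu\|_{L^\infty(\mathbb D)}\le1\}$. For $\tau>0$, $0<r<1$ and a function $g$ on $\mathbb D$ put $E(g,\tau,r)=\int_{\mathbb T}\exp\Big\{\frac{|g(r\zeta)|^2}{\tau\log\frac1{1-r^2}}\Big\}\,ds(\zeta)$. Then the uniform asymptotic tail variance of $\mathcal G$, $$\mathrm{atvar}_u\,\mathcal G:=\inf\Big\{\tau>0:\ \limsup_{r\to1^-}\,\sup_{g\in\mathcal G}E(g,\tau,r)<+\infty\Big\},$$ and the asymptotic tail variance of $\mathcal G$, $$\mathrm{atvar}\,\mathcal G:=\sup_{g\in\mathcal G}\,\inf\Big\{\tau>0:\ \limsup_{r\to1^-}E(g,\tau,r)<+\infty\Big\},$$ are both equal to $1$. -/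

import Mathlib

open MeasureTheory Filter Topology
open scoped ENNReal ComplexConjugate

noncomputable section

/-- Normalized area measure `dx dy / π` on the open unit disk, as a measure on `ℂ`. -/
def diskArea : Measure ℂ :=
  (ENNReal.ofReal Real.pi)⁻¹ • volume.restrict (Metric.ball (0 : ℂ) 1)

/-- Normalized arc length `|dz| / (2π)` on the unit circle, as a measure on `ℂ`: the image of
`dθ / (2π)` on `(0, 2π]` under `θ ↦ exp (i θ)`. -/
def circleArc : Measure ℂ :=
  (ENNReal.ofReal (2 * Real.pi))⁻¹ •
    (volume.restrict (Set.Ioc 0 (2 * Real.pi))).map (circleMap 0 1)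

/-- The Bergman projection `(P f)(z) = ∫_𝔻 f(w) / (1 - z w̄)² dA(w)`.
Only its values at points `z` of the open unit disk are meaningful. -/
def bergmanProjection (f : ℂ → ℂ) (z : ℂ) : ℂ :=
  ∫ w, f w / (1 - z * conj w) ^ 2 ∂diskArea

/-- The exponential mean `∫_𝕋 exp (|g(rζ)|² / (τ log (1/(1-r²)))) ds(ζ)`. -/
def expMean (g : ℂ → ℂ) (τ r : ℝ) : ℝ≥0∞ :=
  ∫⁻ ζ, ENNReal.ofReal
    (Real.exp (‖g (r * ζ)‖ ^ 2 / (τ * Real.log (1 / (1 - r ^ 2))))) ∂circleArc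

/-- The asymptotic tail variance of a single function on the disk. -/
def atvar (g : ℂ → ℂ) : ℝ≥0∞ :=
  sInf (ENNReal.ofReal ''
    {τ : ℝ | 0 < τ ∧ limsup (fun r : ℝ => expMean g τ r) (𝓝[<] 1) < ∞})

/-- The asymptotic tail variance of a family of functions on the disk: the supremum of
the individual asymptotic tail variances. -/
def atvarFamily (G : Set (ℂ → ℂ)) : ℝ≥0∞ :=
  ⨆ g ∈ G, atvar g

/-- The uniform asymptotic tail variance of a family of functions on the disk. -/
def atvarUnif (G : Set (ℂ → ℂ)) : ℝ≥0∞ :=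
  sInf (ENNReal.ofReal ''
    {τ : ℝ | 0 < τ ∧ limsup (fun r : ℝ => ⨆ g ∈ G, expMean g τ r) (𝓝[<] 1) < ∞})

/-- The unit ball of `P L^∞(𝔻)`: the functions `P μ` with `‖μ‖_∞ ≤ 1`. -/
def ballPLinfty : Set (ℂ → ℂ) :=
  bergmanProjection '' {μ : ℂ → ℂ | MemLp μ ∞ diskArea ∧ eLpNorm μ ∞ diskArea ≤ 1}

/-- The function `μ₀(z) = (1 - z̄) / (1 - z)` on the disk. -/
def mu0 (z : ℂ) : ℂ := (1 - conj z) / (1 - z)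

end

/-!
Write `σ` for normalized arc length, `g = Pμ` with `|μ| ≤ 1`, `w(ζ) = r² g(rζ)` and
`L = log (1 / (1 - r²))`.

The upper bound rests on the sub-Gaussian estimate
`∫ exp (2 Re (ν w)) dσ ≤ 16 exp (|ν|² L)` (`lintegral_exp_re_bergmanProjection_le`). Let `Z` be the
left-hand side, `φ = 2 Re (ν w)` and `ψ = exp φ / Z`, a probability density. Then
`log Z = ∫ φ ψ - Ent ψ`, where `Ent ψ = ∫ klFun ψ = ∫ ψ log ψ`. Let `C` be the Cauchy transform of
`ψ` and `u = 2 Re C - 1` its Poisson extension. Since `C + v C'` is the integral of `ψ` against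
`(1 - ζ̄ v)⁻²`, Fubini's theorem gives `∫ φ ψ ≤ 2|ν| ∫_{|v|<r} |C + v C'| dA`
(`norm_integral_mul_bergmanProjection_le`), and
`2|ν||C + v C'| ≤ |ν|² u / (1 - |v|²) + (1 - |v|²) |C + v C'|² / u`. As `u` has mean `1` on every
circle, the first term integrates to exactly `|ν|² L`. For the second one, two facts are combined:

* `|C + v C'|` may be replaced by `|C'| = |∂u|` at the cost of an explicit error with total integral
  at most `4 log 2` (`norm_sq_div_poissonExtension_le`);
* `∫ (1 - |v|²) |∂u|² / u dA ≤ Ent ψ` (`integral_circleFisher_le`), which is Green's formula for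
  `u log u`, whose `∂∂̄`-derivative is `|∂u|² / u`, with Jensen's inequality for the boundary term.

The entropies cancel, and `log Z ≤ |ν|² L + 4 log 2` remains. Averaging over `ν` against a complex
Gaussian turns this into `∫ exp (a |w|² / L) dσ ≤ 16 / (1 - a)`, and Jensen's inequality in `a`
improves this to `10 (1 - a)^(-3/2)` for the smaller values of `a`.

For the lower bound, polar coordinates and Cauchy's formula give
`z² P μ₀ (z) = -log (1 - z) - z`. Hence `|w|² / L` is about `log (1 / (1 - r))` on an arc of length
`1 - r` next to `1`, and this arc alone contributes `(1 - r)^(1 - a)`, up to a constant, to the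
integral. The two asymptotic tail variances are squeezed between these bounds.
-/

open InformationTheory

/-! ### Normalized arc length and area -/

lemma lintegral_circleArc {f : ℂ → ℝ≥0∞} (hf : Measurable f) :
    ∫⁻ ζ, f ζ ∂circleArc = (ENNReal.ofReal (2 * Real.pi))⁻¹ *
      ∫⁻ θ in Set.Ioc 0 (2 * Real.pi), f (circleMap 0 1 θ) := by
  rw [circleArc, lintegral_smul_measure, lintegral_map hf (measurable_circleMap 0 1), smul_eq_mul]

lemma integral_circleArc {E : Type*} [NormedAddCommGroup E] [NormedSpace ℝ E] {f : ℂ → E}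
    (hf : AEStronglyMeasurable f circleArc) :
    ∫ ζ, f ζ ∂circleArc = Real.circleAverage f 0 1 := by
  have h2 : (ENNReal.ofReal (2 * Real.pi))⁻¹ ≠ 0 := ENNReal.inv_ne_zero.2 ENNReal.ofReal_ne_top
  have hf' : AEStronglyMeasurable f
      ((volume.restrict (Set.Ioc 0 (2 * Real.pi))).map (circleMap 0 1)) := by
    rw [circleArc] at hf
    exact hf.mono_ac (Measure.AbsolutelyContinuous.rfl.smul_right h2)
  rw [circleArc, integral_smul_measure, integral_map (measurable_circleMap 0 1).aemeasurable hf',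
    Real.circleAverage_def, intervalIntegral.integral_of_le Real.two_pi_pos.le,
    ENNReal.toReal_inv, ENNReal.toReal_ofReal Real.two_pi_pos.le]

instance : IsProbabilityMeasure circleArc := by
  constructor
  have h : (0 : ℝ) < 2 * Real.pi := Real.two_pi_pos
  rw [circleArc, Measure.smul_apply, Measure.map_apply (measurable_circleMap 0 1) .univ]
  simp only [Set.preimage_univ, Measure.restrict_apply_univ, Real.volume_Ioc, sub_zero,
    smul_eq_mul]
  exact ENNReal.inv_mul_cancel (by simp [Real.pi_pos]) ENNReal.ofReal_ne_top

lemma ae_norm_eq_one_circleArc : ∀ᵐ ζ ∂circleArc, ‖ζ‖ = 1 := by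
  rw [circleArc]
  refine Measure.ae_smul_measure ?_ _
  rw [ae_map_iff (measurable_circleMap 0 1).aemeasurable
    (isClosed_eq continuous_norm continuous_const).measurableSet]
  exact ae_of_all _ fun θ => by simp

instance : IsFiniteMeasure diskArea := by
  constructor
  rw [diskArea, Measure.smul_apply, Measure.restrict_apply_univ, smul_eq_mul, lt_top_iff_ne_top]
  exact ENNReal.mul_ne_top (by simp [Real.pi_pos]) measure_ball_lt_top.ne

lemma ae_norm_lt_one_diskArea : ∀ᵐ z ∂diskArea, ‖z‖ < 1 := by
  rw [diskArea]
  refine Measure.ae_smul_measure ?_ _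
  filter_upwards [ae_restrict_mem measurableSet_ball] with z hz
  simpa using hz

lemma polarCoord_symm_eq_circleMap (p : ℝ × ℝ) :
    Complex.polarCoord.symm p = circleMap 0 p.1 p.2 := by
  rw [Complex.polarCoord_symm_apply, circleMap, zero_add, Complex.exp_mul_I]
  simp

/-- Integration in polar coordinates over the unit disk. -/
lemma integral_diskArea {E : Type*} [NormedAddCommGroup E] [NormedSpace ℝ E] {f : ℂ → E}
    (hc : ContinuousOn f (Metric.ball 0 1)) (hf : Integrable f diskArea) :
    ∫ z, f z ∂diskArea = ∫ t in (0 : ℝ)..1, (2 * t) • Real.circleAverage f 0 t := by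
  have hpi : (ENNReal.ofReal Real.pi)⁻¹ ≠ 0 := by simp
  have hfb : IntegrableOn f (Metric.ball 0 1) := by
    rw [diskArea, integrable_smul_measure hpi (by simp [Real.pi_pos])] at hf
    exact hf
  set F : ℂ → E := (Metric.ball (0 : ℂ) 1).indicator f with hF
  have hFi : Integrable F := hfb.integrable_indicator measurableSet_ball
  have hind : ∀ p : ℝ × ℝ, p.1 • F (Complex.polarCoord.symm p)
      = {p : ℝ × ℝ | |p.1| < 1}.indicator (fun p => p.1 • f (circleMap 0 p.1 p.2)) p := by
    intro p
    rw [polarCoord_symm_eq_circleMap]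
    by_cases h : |p.1| < 1
    · rw [Set.indicator_of_mem (by exact h), hF, Set.indicator_of_mem (by simpa using h)]
    · rw [Set.indicator_of_notMem (by exact h), hF, Set.indicator_of_notMem (by simpa using h),
        smul_zero]
  set S : Set (ℝ × ℝ) := Set.Ioo 0 1 ×ˢ Set.Ioo (-Real.pi) Real.pi with hS
  have hSm : MeasurableSet S := measurableSet_Ioo.prod measurableSet_Ioo
  have htar : {p : ℝ × ℝ | |p.1| < 1} ∩ polarCoord.target = S := by
    ext p
    simp only [polarCoord_target, hS, Set.mem_inter_iff, Set.mem_ofPred_eq, Set.mem_prod,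
      Set.mem_Ioi, Set.mem_Ioo]
    constructor
    · rintro ⟨h1, h2, h3⟩
      exact ⟨⟨h2, by rwa [abs_of_pos h2] at h1⟩, h3⟩
    · rintro ⟨⟨h1, h2⟩, h3⟩
      exact ⟨by rwa [abs_of_pos h1], h1, h3⟩
  have hmeas : MeasurableSet {p : ℝ × ℝ | |p.1| < 1} :=
    measurableSet_lt (by fun_prop) measurable_const
  -- the integrand in polar coordinates is integrable since its norm has finite integral
  have hcont : ContinuousOn (fun p : ℝ × ℝ => p.1 • f (circleMap 0 p.1 p.2)) S := by
    refine continuousOn_fst.smul (hc.comp (by unfold circleMap; fun_prop) ?_)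
    rintro p ⟨hp, -⟩
    simpa [abs_of_pos hp.1] using hp.2
  have hint : IntegrableOn (fun p : ℝ × ℝ => p.1 • f (circleMap 0 p.1 p.2)) S := by
    refine ⟨hcont.aestronglyMeasurable hSm, ?_⟩
    have h := hFi.2
    rw [HasFiniteIntegral, ← Complex.lintegral_comp_polarCoord_symm] at h
    rw [HasFiniteIntegral]
    refine lt_of_eq_of_lt ?_ h
    rw [← htar, ← Measure.restrict_restrict hmeas, ← lintegral_indicator hmeas]
    refine setLIntegral_congr_fun polarCoord.open_target.measurableSet ?_
    intro p hp
    have hp0 : 0 < p.1 := by simpa using hp.1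
    have e1 : ENNReal.ofReal p.1 = ‖p.1‖ₑ := by
      rw [← ofReal_norm, Real.norm_of_nonneg hp0.le]
    simp only [smul_eq_mul]
    rw [e1, ← enorm_smul, hind p]
    by_cases h : p ∈ {p : ℝ × ℝ | |p.1| < 1}
    · rw [Set.indicator_of_mem h, Set.indicator_of_mem h]
    · rw [Set.indicator_of_notMem h, Set.indicator_of_notMem h, enorm_zero]
  have key : ∫ z in Metric.ball 0 1, f z
      = ∫ t in (0 : ℝ)..1, ∫ θ in (0 : ℝ)..2 * Real.pi, t • f (circleMap 0 t θ) := by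
    rw [← integral_indicator measurableSet_ball, ← hF, ← Complex.integral_comp_polarCoord_symm]
    simp_rw [hind]
    rw [integral_indicator hmeas, Measure.restrict_restrict hmeas, htar, hS,
      Measure.volume_eq_prod, setIntegral_prod _ hint, intervalIntegral.integral_of_le zero_le_one,
      integral_Ioc_eq_integral_Ioo]
    refine setIntegral_congr_fun measurableSet_Ioo fun t _ => ?_
    have hper : Function.Periodic (fun θ => t • f (circleMap 0 t θ)) (2 * Real.pi) := fun θ => by
      simp only [periodic_circleMap 0 t θ]
    have := hper.intervalIntegral_add_eq (-Real.pi) 0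
    simp only [zero_add] at this
    rw [← this, show -Real.pi + 2 * Real.pi = Real.pi by ring,
      intervalIntegral.integral_of_le (by linarith [Real.pi_pos]), integral_Ioc_eq_integral_Ioo]
  rw [diskArea, integral_smul_measure, key, ENNReal.toReal_inv,
    ENNReal.toReal_ofReal Real.pi_pos.le, ← intervalIntegral.integral_smul]
  refine intervalIntegral.integral_congr fun t _ => ?_
  simp only [Real.circleAverage_def, intervalIntegral.integral_smul, smul_smul]
  congr 1
  field_simp

/-! ### Cauchy transforms and Poisson integrals on the disk -/

/-- The Cauchy transform `∫ ψ(ζ) / (1 - ζ̄ v) ds(ζ)` of a real density on the unit circle. -/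
noncomputable def cauchyTransform (ψ : ℂ → ℝ) (v : ℂ) : ℂ :=
  ∫ ζ, (ψ ζ : ℂ) / (1 - conj ζ * v) ∂circleArc

/-- The Poisson extension of a real density on the unit circle, in the form
`2 Re C - ∫ ψ` with `C` its Cauchy transform, which makes its harmonicity evident. -/
noncomputable def poissonExtension (ψ : ℂ → ℝ) (v : ℂ) : ℝ :=
  2 * (cauchyTransform ψ v).re - ∫ ζ, ψ ζ ∂circleArc

lemma one_sub_le_norm_one_sub {ζ v : ℂ} (hζ : ‖ζ‖ = 1) : 1 - ‖v‖ ≤ ‖1 - conj ζ * v‖ := by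
  have := norm_sub_norm_le (1 : ℂ) (conj ζ * v)
  simpa [hζ] using this

lemma one_sub_conj_mul_ne_zero {ζ v : ℂ} (hζ : ‖ζ‖ = 1) (hv : ‖v‖ < 1) : 1 - conj ζ * v ≠ 0 := by
  have := one_sub_le_norm_one_sub (v := v) hζ
  exact norm_pos_iff.1 (by linarith)

lemma integrable_mul_bounded_circleArc {ψ : ℂ → ℝ} (hψ : Integrable ψ circleArc) {k : ℂ → ℂ}
    (hk : Measurable k) (C : ℝ) (hC : ∀ ζ, ‖ζ‖ = 1 → ‖k ζ‖ ≤ C) :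
    Integrable (fun ζ => (ψ ζ : ℂ) * k ζ) circleArc := by
  refine Integrable.mul_bdd (c := C) hψ.ofReal hk.aestronglyMeasurable ?_
  filter_upwards [ae_norm_eq_one_circleArc] with ζ hζ using hC ζ hζ

lemma integrable_cauchyKernel {ψ : ℂ → ℝ} (hψ : Integrable ψ circleArc) {v : ℂ} (hv : ‖v‖ < 1) :
    Integrable (fun ζ => (ψ ζ : ℂ) / (1 - conj ζ * v)) circleArc := by
  simp_rw [div_eq_mul_inv]
  refine integrable_mul_bounded_circleArc hψ (by fun_prop) (1 - ‖v‖)⁻¹ fun ζ hζ => ?_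
  rw [norm_inv]
  exact inv_anti₀ (by linarith) (one_sub_le_norm_one_sub hζ)

lemma norm_inv_one_sub_sq_le {ζ v : ℂ} (hζ : ‖ζ‖ = 1) {R : ℝ} (hv : ‖v‖ ≤ R) (hR : R < 1) :
    ‖((1 - conj ζ * v) ^ 2)⁻¹‖ ≤ ((1 - R) ^ 2)⁻¹ := by
  rw [norm_inv, norm_pow]
  have h := one_sub_le_norm_one_sub (v := v) hζ
  exact inv_anti₀ (pow_pos (by linarith) 2) (pow_le_pow_left₀ (by linarith) (by linarith) 2)

lemma integrable_conj_mul_cauchyKernel_sq {ψ : ℂ → ℝ} (hψ : Integrable ψ circleArc) {v : ℂ}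
    (hv : ‖v‖ < 1) :
    Integrable (fun ζ => (ψ ζ : ℂ) * (conj ζ * ((1 - conj ζ * v) ^ 2)⁻¹)) circleArc :=
  integrable_mul_bounded_circleArc hψ (by fun_prop) ((1 - ‖v‖) ^ 2)⁻¹ fun _ hζ => by
    rw [norm_mul, RCLike.norm_conj, hζ, one_mul]
    exact norm_inv_one_sub_sq_le hζ le_rfl hv

lemma hasDerivAt_cauchyTransform {ψ : ℂ → ℝ} (hψ : Integrable ψ circleArc) {v : ℂ}
    (hv : ‖v‖ < 1) :
    HasDerivAt (cauchyTransform ψ)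
      (∫ ζ, (ψ ζ : ℂ) * (conj ζ * ((1 - conj ζ * v) ^ 2)⁻¹) ∂circleArc) v := by
  obtain ⟨R, hvR, hR⟩ := exists_between hv
  have hs : Metric.ball (0 : ℂ) R ∈ 𝓝 v := Metric.isOpen_ball.mem_nhds (by simpa using hvR)
  refine (hasDerivAt_integral_of_dominated_loc_of_deriv_le (s := Metric.ball (0 : ℂ) R)
    (F := fun v ζ => (ψ ζ : ℂ) / (1 - conj ζ * v))
    (F' := fun v ζ => (ψ ζ : ℂ) * (conj ζ * ((1 - conj ζ * v) ^ 2)⁻¹))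
    (bound := fun ζ => |ψ ζ| * ((1 - R) ^ 2)⁻¹) hs ?_ (integrable_cauchyKernel hψ hv)
    (integrable_conj_mul_cauchyKernel_sq hψ hv).aestronglyMeasurable ?_
    (hψ.abs.mul_const _) ?_).2
  · filter_upwards [hs] with w hw
    exact (integrable_cauchyKernel hψ (by
      have : ‖w‖ < R := by simpa using hw
      linarith)).aestronglyMeasurable
  · filter_upwards [ae_norm_eq_one_circleArc] with ζ hζ w hw
    have hw' : ‖w‖ < R := by simpa using hw
    rw [norm_mul, norm_mul, RCLike.norm_conj, hζ, one_mul, Complex.norm_real, Real.norm_eq_abs]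
    exact mul_le_mul_of_nonneg_left (norm_inv_one_sub_sq_le hζ hw'.le hR) (abs_nonneg _)
  · filter_upwards [ae_norm_eq_one_circleArc] with ζ hζ w hw
    have hw' : ‖w‖ < R := by simpa using hw
    have hne := one_sub_conj_mul_ne_zero (v := w) hζ (by linarith)
    have h1 : HasDerivAt (fun w => 1 - conj ζ * w) (-(conj ζ)) w := by
      simpa using ((hasDerivAt_id w).const_mul (conj ζ)).const_sub 1
    have h2 := (h1.inv hne).const_mul (ψ ζ : ℂ)
    simp_rw [div_eq_mul_inv]
    refine h2.congr_deriv ?_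
    field_simp

lemma deriv_cauchyTransform {ψ : ℂ → ℝ} (hψ : Integrable ψ circleArc) {v : ℂ} (hv : ‖v‖ < 1) :
    deriv (cauchyTransform ψ) v =
      ∫ ζ, (ψ ζ : ℂ) * (conj ζ * ((1 - conj ζ * v) ^ 2)⁻¹) ∂circleArc :=
  (hasDerivAt_cauchyTransform hψ hv).deriv

lemma differentiableOn_cauchyTransform {ψ : ℂ → ℝ} (hψ : Integrable ψ circleArc) :
    DifferentiableOn ℂ (cauchyTransform ψ) (Metric.ball 0 1) := fun _ hv =>
  (hasDerivAt_cauchyTransform hψ (by simpa using hv)).differentiableAt.differentiableWithinAt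

lemma cauchyTransform_zero (ψ : ℂ → ℝ) : cauchyTransform ψ 0 = (∫ ζ, ψ ζ ∂circleArc : ℝ) := by
  simp [cauchyTransform, integral_complex_ofReal]

/-- `(v C(v))' = C + v C'` is the integral of the density against the Bergman-type kernel
`(1 - ζ̄ v)⁻²`. -/
lemma cauchyTransform_add_mul_deriv {ψ : ℂ → ℝ} (hψ : Integrable ψ circleArc) {v : ℂ}
    (hv : ‖v‖ < 1) :
    cauchyTransform ψ v + v * deriv (cauchyTransform ψ) v =
      ∫ ζ, (ψ ζ : ℂ) * ((1 - conj ζ * v) ^ 2)⁻¹ ∂circleArc := by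
  rw [deriv_cauchyTransform hψ hv, cauchyTransform, ← integral_const_mul,
    ← integral_add (integrable_cauchyKernel hψ hv)
      ((integrable_conj_mul_cauchyKernel_sq hψ hv).const_mul v)]
  refine integral_congr_ae ?_
  filter_upwards [ae_norm_eq_one_circleArc] with ζ hζ
  have hne := one_sub_conj_mul_ne_zero hζ hv
  field_simp
  ring

lemma poissonKernel_eq {ζ v : ℂ} (hζ : ‖ζ‖ = 1) (hv : ‖v‖ < 1) :
    2 * (1 / (1 - conj ζ * v)).re - 1 = (1 - ‖v‖ ^ 2) * ‖((1 - conj ζ * v) ^ 2)⁻¹‖ := by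
  have hne := one_sub_conj_mul_ne_zero hζ hv
  set w := conj ζ * v with hw
  have hwv : ‖v‖ ^ 2 = Complex.normSq w := by
    rw [← Complex.sq_norm, hw, norm_mul, RCLike.norm_conj, hζ, one_mul]
  have hn : ‖((1 - w) ^ 2)⁻¹‖ = (Complex.normSq (1 - w))⁻¹ := by
    rw [norm_inv, norm_pow, Complex.sq_norm]
  have h0 : Complex.normSq (1 - w) ≠ 0 := by simpa using hne
  rw [hn, hwv, one_div, Complex.inv_re]
  field_simp
  simp [Complex.normSq_apply]
  ring

lemma poissonExtension_eq {ψ : ℂ → ℝ} (hψ : Integrable ψ circleArc) {v : ℂ} (hv : ‖v‖ < 1) :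
    poissonExtension ψ v =
      (1 - ‖v‖ ^ 2) * ∫ ζ, ψ ζ * ‖((1 - conj ζ * v) ^ 2)⁻¹‖ ∂circleArc := by
  have h1 : (cauchyTransform ψ v).re = ∫ ζ, ((ψ ζ : ℂ) / (1 - conj ζ * v)).re ∂circleArc :=
    (integral_re (integrable_cauchyKernel hψ hv)).symm
  have hre : Integrable (fun ζ => ((ψ ζ : ℂ) / (1 - conj ζ * v)).re) circleArc :=
    (integrable_cauchyKernel hψ hv).re
  rw [poissonExtension, h1, ← integral_const_mul, ← integral_sub (hre.const_mul 2) hψ,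
    ← integral_const_mul]
  refine integral_congr_ae ?_
  filter_upwards [ae_norm_eq_one_circleArc] with ζ hζ
  have := poissonKernel_eq hζ hv
  have h2 : ((ψ ζ : ℂ) / (1 - conj ζ * v)).re = ψ ζ * (1 / (1 - conj ζ * v)).re := by
    rw [div_eq_mul_one_div, Complex.re_ofReal_mul]
  rw [h2]
  linear_combination ψ ζ * this

lemma integrable_mul_norm_kernel {ψ : ℂ → ℝ} (hψ : Integrable ψ circleArc) {v : ℂ}
    (hv : ‖v‖ < 1) :
    Integrable (fun ζ => ψ ζ * ‖((1 - conj ζ * v) ^ 2)⁻¹‖) circleArc := by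
  refine Integrable.mul_bdd (c := ((1 - ‖v‖) ^ 2)⁻¹) hψ
    (Measurable.aestronglyMeasurable (by fun_prop)) ?_
  filter_upwards [ae_norm_eq_one_circleArc] with ζ hζ
  rw [norm_norm]
  exact norm_inv_one_sub_sq_le hζ le_rfl hv

lemma norm_integral_le_poissonExtension {ψ : ℂ → ℝ} (hψ : Integrable ψ circleArc)
    (h0 : ∀ ζ, 0 ≤ ψ ζ) {v : ℂ} (hv : ‖v‖ < 1) {k : ℂ → ℂ}
    (hk : ∀ ζ, ‖ζ‖ = 1 → ‖k ζ‖ = ‖((1 - conj ζ * v) ^ 2)⁻¹‖) :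
    (1 - ‖v‖ ^ 2) * ‖∫ ζ, (ψ ζ : ℂ) * k ζ ∂circleArc‖ ≤ poissonExtension ψ v := by
  have hδ : 0 ≤ 1 - ‖v‖ ^ 2 := by nlinarith [norm_nonneg v]
  rw [poissonExtension_eq hψ hv]
  refine mul_le_mul_of_nonneg_left ?_ hδ
  refine (norm_integral_le_integral_norm _).trans (integral_congr_ae ?_).le
  filter_upwards [ae_norm_eq_one_circleArc] with ζ hζ
  rw [norm_mul, hk ζ hζ, Complex.norm_real, Real.norm_of_nonneg (h0 ζ)]

lemma norm_cauchyTransform_add_mul_deriv_le {ψ : ℂ → ℝ} (hψ : Integrable ψ circleArc)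
    (h0 : ∀ ζ, 0 ≤ ψ ζ) {v : ℂ} (hv : ‖v‖ < 1) :
    (1 - ‖v‖ ^ 2) * ‖cauchyTransform ψ v + v * deriv (cauchyTransform ψ) v‖
      ≤ poissonExtension ψ v := by
  rw [cauchyTransform_add_mul_deriv hψ hv]
  exact norm_integral_le_poissonExtension hψ h0 hv fun ζ hζ => rfl

/-- Cauchy–Schwarz for the Cauchy transform of a probability density. The square is completed by
hand: `2c|1 - ζ̄v|⁻¹ ≤ c² + |1 - ζ̄v|⁻²` is integrated with `c = |C(v)|`. -/
lemma norm_sq_cauchyTransform_le {ψ : ℂ → ℝ} (hψ : Integrable ψ circleArc)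
    (h0 : ∀ ζ, 0 ≤ ψ ζ) (h1 : ∫ ζ, ψ ζ ∂circleArc = 1) {v : ℂ} (hv : ‖v‖ < 1) :
    (1 - ‖v‖ ^ 2) * ‖cauchyTransform ψ v‖ ^ 2 ≤ poissonExtension ψ v := by
  have hδ : 0 ≤ 1 - ‖v‖ ^ 2 := by nlinarith [norm_nonneg v]
  rw [poissonExtension_eq hψ hv]
  refine mul_le_mul_of_nonneg_left ?_ hδ
  set c := ‖cauchyTransform ψ v‖ with hc
  have hle : c ≤ ∫ ζ, ‖(ψ ζ : ℂ) / (1 - conj ζ * v)‖ ∂circleArc := norm_integral_le_integral_norm _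
  have hint := (integrable_cauchyKernel hψ hv).norm
  have h2 : ∫ ζ, 2 * c * ‖(ψ ζ : ℂ) / (1 - conj ζ * v)‖ ∂circleArc
      ≤ ∫ ζ, (c ^ 2 * ψ ζ + ψ ζ * ‖((1 - conj ζ * v) ^ 2)⁻¹‖) ∂circleArc := by
    refine integral_mono (hint.const_mul _)
      ((hψ.const_mul _).add (integrable_mul_norm_kernel hψ hv)) fun ζ => ?_
    simp only [norm_div, Complex.norm_real, Real.norm_of_nonneg (h0 ζ), norm_inv, norm_pow]
    rw [div_eq_mul_inv, ← inv_pow]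
    nlinarith [mul_nonneg (h0 ζ) (sq_nonneg (c - ‖1 - conj ζ * v‖⁻¹))]
  rw [integral_const_mul, integral_add (hψ.const_mul _) (integrable_mul_norm_kernel hψ hv),
    integral_const_mul, h1] at h2
  have hc0 : 0 ≤ c := norm_nonneg _
  nlinarith

lemma poissonExtension_pos {ψ : ℂ → ℝ} (hψ : Integrable ψ circleArc) (h0 : ∀ ζ, 0 < ψ ζ)
    {v : ℂ} (hv : ‖v‖ < 1) : 0 < poissonExtension ψ v := by
  have hδ : 0 < 1 - ‖v‖ ^ 2 := by nlinarith [norm_nonneg v]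
  rw [poissonExtension_eq hψ hv]
  refine mul_pos hδ ((integral_pos_iff_support_of_nonneg_ae (ae_of_all _ fun ζ =>
    mul_nonneg (h0 ζ).le (norm_nonneg _)) (integrable_mul_norm_kernel hψ hv)).2 ?_)
  have hsup : ∀ᵐ ζ ∂circleArc,
      ζ ∈ Function.support fun ζ => ψ ζ * ‖((1 - conj ζ * v) ^ 2)⁻¹‖ := by
    filter_upwards [ae_norm_eq_one_circleArc] with ζ hζ
    have := one_sub_conj_mul_ne_zero hζ hv
    simp [(h0 ζ).ne', this]
  have : circleArc (Function.support fun ζ => ψ ζ * ‖((1 - conj ζ * v) ^ 2)⁻¹‖) = 1 := by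
    exact (measure_congr (eventuallyEq_univ.2 hsup)).trans measure_univ
  rw [this]; exact one_pos

/-- Mean value property of the Poisson extension. -/
lemma circleAverage_poissonExtension {ψ : ℂ → ℝ} (hψ : Integrable ψ circleArc) {t : ℝ}
    (ht0 : 0 ≤ t) (ht : t < 1) :
    Real.circleAverage (poissonExtension ψ) 0 t = ∫ ζ, ψ ζ ∂circleArc := by
  have hsub : Metric.closedBall (0 : ℂ) |t| ⊆ Metric.ball 0 1 :=
    Metric.closedBall_subset_ball (by rwa [abs_of_nonneg ht0])
  have hd : DifferentiableOn ℂ (fun z => 2 * cauchyTransform ψ z - (∫ ζ, ψ ζ ∂circleArc : ℝ))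
      (Metric.ball 0 1) := ((differentiableOn_cauchyTransform hψ).const_mul 2).sub_const _
  have h1 := (hd.diffContOnCl_ball hsub).circleAverage
  have hci :
      CircleIntegrable (fun z => 2 * cauchyTransform ψ z - (∫ ζ, ψ ζ ∂circleArc : ℝ)) 0 t := by
    refine (hd.continuousOn.mono ?_).circleIntegrable'
    exact Metric.sphere_subset_closedBall.trans hsub
  have h2 := Complex.reCLM.circleAverage_comp_comm hci
  rw [h1] at h2
  convert h2 using 1
  · congr 1
    ext z
    simp [poissonExtension]
  · simp [cauchyTransform_zero]
    ring

/-- The pointwise inequality `δ|k|²/u ≤ δ|C'|²/u + (u + 1) / (y(1 + y))` for `k = C + v C'`,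
`δ = 1 - |v|²` and `y = √δ`. It interpolates between the trivial bound `δ|k| ≤ u` and
`|k| ≤ |v||C'| + |C|` with weights `y/(1+y)` and `1/(1+y)`. -/
lemma norm_sq_div_poissonExtension_le {ψ : ℂ → ℝ} (hψ : Integrable ψ circleArc)
    (h0 : ∀ ζ, 0 < ψ ζ) (h1 : ∫ ζ, ψ ζ ∂circleArc = 1) {v : ℂ} (hv : ‖v‖ < 1) :
    (1 - ‖v‖ ^ 2) * ‖cauchyTransform ψ v + v * deriv (cauchyTransform ψ) v‖ ^ 2 /
        poissonExtension ψ v ≤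
      (1 - ‖v‖ ^ 2) * (‖deriv (cauchyTransform ψ) v‖ ^ 2 / poissonExtension ψ v) +
        (poissonExtension ψ v + 1) / (√(1 - ‖v‖ ^ 2) * (1 + √(1 - ‖v‖ ^ 2))) := by
  have hδ : 0 < 1 - ‖v‖ ^ 2 := by nlinarith [norm_nonneg v]
  have hu := poissonExtension_pos hψ h0 hv
  have hk := norm_cauchyTransform_add_mul_deriv_le hψ (fun ζ => (h0 ζ).le) hv
  have hj := norm_sq_cauchyTransform_le hψ (fun ζ => (h0 ζ).le) h1 hv
  have htri : ‖cauchyTransform ψ v + v * deriv (cauchyTransform ψ) v‖ ≤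
      ‖v‖ * ‖deriv (cauchyTransform ψ) v‖ + ‖cauchyTransform ψ v‖ := by
    rw [add_comm, ← norm_mul]
    exact norm_add_le _ _
  set k := ‖cauchyTransform ψ v + v * deriv (cauchyTransform ψ) v‖
  set d := ‖deriv (cauchyTransform ψ) v‖
  set j := ‖cauchyTransform ψ v‖
  set u := poissonExtension ψ v
  set y := √(1 - ‖v‖ ^ 2) with hy
  have hy0 : 0 < y := Real.sqrt_pos.2 hδ
  have hy2 : 1 - ‖v‖ ^ 2 = y ^ 2 := (Real.sq_sqrt hδ.le).symm
  have hk0 : 0 ≤ k := norm_nonneg _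
  have hd0 : 0 ≤ d := norm_nonneg _
  have hj0 : 0 ≤ j := norm_nonneg _
  have hv0 : 0 ≤ ‖v‖ := norm_nonneg _
  rw [hy2] at hk hj ⊢
  have e1 : y ^ 4 * k ^ 2 ≤ u ^ 2 := by
    calc y ^ 4 * k ^ 2 = (y ^ 2 * k) ^ 2 := by ring
      _ ≤ u ^ 2 := pow_le_pow_left₀ (by positivity) hk 2
  have e2 : y * k ^ 2 ≤ y * (1 + y) * d ^ 2 + j ^ 2 := by
    have hsq : k ^ 2 ≤ (‖v‖ * d + j) ^ 2 := pow_le_pow_left₀ hk0 htri 2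
    have hv2 : ‖v‖ ^ 2 = 1 - y ^ 2 := by linarith
    have hAM : y * (‖v‖ * d + j) ^ 2 ≤ y * (1 + y) * d ^ 2 + j ^ 2 := by
      have hy1 : y ≤ 1 := by nlinarith
      have hs : (y * (1 + y) * d ^ 2 + j ^ 2) - y * (‖v‖ * d + j) ^ 2
          = y ^ 2 * (1 + y) * d ^ 2 - 2 * y * ‖v‖ * d * j + (1 - y) * j ^ 2 := by
        linear_combination (-y * d ^ 2) * hv2
      have : 0 ≤ (1 + y) * (y ^ 2 * (1 + y) * d ^ 2 - 2 * y * ‖v‖ * d * j + (1 - y) * j ^ 2) := by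
        have : (1 + y) * (y ^ 2 * (1 + y) * d ^ 2 - 2 * y * ‖v‖ * d * j + (1 - y) * j ^ 2)
            = (y * (1 + y) * d - ‖v‖ * j) ^ 2 := by
          linear_combination (-j ^ 2) * hv2
        rw [this]; positivity
      have := nonneg_of_mul_nonneg_right this (by positivity)
      linarith
    nlinarith
  rw [← sub_nonneg]
  have : y ^ 2 * (d ^ 2 / u) + (u + 1) / (y * (1 + y)) - y ^ 2 * k ^ 2 / u
      = (y ^ 3 * (1 + y) * d ^ 2 + (u + 1) * u - y ^ 3 * (1 + y) * k ^ 2) /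
        (u * (y * (1 + y))) := by
    field_simp
  rw [this]
  refine div_nonneg ?_ (by positivity)
  nlinarith [mul_le_mul_of_nonneg_left e2 (sq_nonneg y)]

/-! ### The entropy of the Poisson extension on concentric circles -/

lemma hasDerivAt_intervalIntegral_of_continuousOn {G G' : ℝ → ℝ → ℝ} {s : Set ℝ} (hs : IsOpen s)
    {a b : ℝ} (hG : ∀ x ∈ s, Continuous (G x))
    (hG' : ContinuousOn (Function.uncurry G') (s ×ˢ Set.univ))
    (hd : ∀ x ∈ s, ∀ θ, HasDerivAt (fun x => G x θ) (G' x θ) x) {x : ℝ} (hx : x ∈ s) :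
    HasDerivAt (fun x => ∫ θ in a..b, G x θ) (∫ θ in a..b, G' x θ) x := by
  obtain ⟨ε, hε, hεs⟩ := Metric.nhds_basis_closedBall.mem_iff.1 (hs.mem_nhds hx)
  obtain ⟨C, hC⟩ := ((isCompact_closedBall x ε).prod
    (isCompact_uIcc (a := a) (b := b))).exists_bound_of_continuousOn
    (hG'.mono (Set.prod_mono hεs (Set.subset_univ _)))
  refine (intervalIntegral.hasDerivAt_integral_of_dominated_loc_of_deriv_le
    (s := Metric.closedBall x ε) (bound := fun _ => C) (Metric.closedBall_mem_nhds x hε) ?_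
    ((hG x hx).intervalIntegrable _ _) ?_ ?_ intervalIntegrable_const ?_).2
  · filter_upwards [hs.mem_nhds hx] with y hy using (hG y hy).aestronglyMeasurable
  · have : Continuous (G' x) := by
      have h := hG'.comp_continuous (f := fun θ : ℝ => (x, θ)) (by fun_prop)
        (fun θ => ⟨hx, trivial⟩)
      exact h
    exact this.aestronglyMeasurable
  · exact ae_of_all _ fun θ hθ y hy => hC (y, θ) ⟨hy, Set.uIoc_subset_uIcc hθ⟩
  · exact ae_of_all _ fun θ _ y hy => hd y (hεs hy) θ

lemma poissonExtension_one {v : ℂ} (hv : ‖v‖ < 1) : poissonExtension (fun _ => 1) v = 1 := by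
  have h1 : Integrable (fun _ : ℂ => (1 : ℝ)) circleArc := integrable_const 1
  have hd : DifferentiableOn ℂ (fun ζ : ℂ => 1 / (1 - ζ * conj v)) (Metric.closedBall 0 |1|) := by
    refine fun ζ hζ => DifferentiableAt.differentiableWithinAt ?_
    have hζ' : ‖ζ‖ ≤ 1 := by simpa using hζ
    have hne : 1 - ζ * conj v ≠ 0 := by
      intro h
      have : ‖ζ * conj v‖ = 1 := by rw [← sub_eq_zero.1 h, norm_one]
      rw [norm_mul, RCLike.norm_conj] at this
      nlinarith [norm_nonneg v, norm_nonneg ζ]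
    fun_prop (disch := assumption)
  have h2 := (hd.mono (closure_ball (0 : ℂ) (r := |1|) (by simp)).subset).diffContOnCl.circleAverage
  have hm : Measurable (fun ζ : ℂ => 1 / (1 - ζ * conj v)) := by fun_prop
  rw [← integral_circleArc hm.aestronglyMeasurable] at h2
  have h3 : cauchyTransform (fun _ => 1) v = conj (∫ ζ, 1 / (1 - ζ * conj v) ∂circleArc) := by
    rw [cauchyTransform, ← integral_conj]
    simp
  rw [poissonExtension, h3, h2]
  norm_num

/-- Jensen's inequality for the Poisson kernel and the convex function `t log t + 1 - t`. -/
lemma klFun_poissonExtension_le {ψ : ℂ → ℝ} (hψ : Integrable ψ circleArc) (h0 : ∀ ζ, 0 < ψ ζ)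
    (hkl : Integrable (fun ζ => klFun (ψ ζ)) circleArc) {v : ℂ} (hv : ‖v‖ < 1) :
    klFun (poissonExtension ψ v) ≤ poissonExtension (fun ζ => klFun (ψ ζ)) v := by
  have hu := poissonExtension_pos hψ h0 hv
  have hδ : 0 < 1 - ‖v‖ ^ 2 := by nlinarith [norm_nonneg v]
  set u := poissonExtension ψ v with hudef
  have htan : ∀ x, 0 < x → klFun u - u * Real.log u + Real.log u * x ≤ klFun x := by
    intro x hx
    have h := Real.log_le_sub_one_of_pos (div_pos hu hx)
    rw [Real.log_div hu.ne' hx.ne'] at h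
    have h' := mul_le_mul_of_nonneg_left h hx.le
    have e : x * (u / x - 1) = u - x := by field_simp
    rw [e] at h'
    simp only [klFun]
    linarith
  have h1 : Integrable (fun _ : ℂ => (1 : ℝ)) circleArc := integrable_const 1
  have e1 := poissonExtension_eq h1 hv
  rw [poissonExtension_one hv] at e1
  have e2 := poissonExtension_eq hψ hv
  rw [poissonExtension_eq hkl hv]
  set K : ℂ → ℝ := fun ζ => ‖((1 - conj ζ * v) ^ 2)⁻¹‖ with hK
  have i1 : Integrable (fun ζ => 1 * K ζ) circleArc := integrable_mul_norm_kernel h1 hv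
  have i2 : Integrable (fun ζ => ψ ζ * K ζ) circleArc := integrable_mul_norm_kernel hψ hv
  have hle : ∫ ζ, ((klFun u - u * Real.log u) * (1 * K ζ) + Real.log u * (ψ ζ * K ζ)) ∂circleArc
      ≤ ∫ ζ, klFun (ψ ζ) * K ζ ∂circleArc := by
    refine integral_mono ((i1.const_mul _).add (i2.const_mul _))
      (integrable_mul_norm_kernel hkl hv) fun ζ => ?_
    have := mul_le_mul_of_nonneg_right (htan (ψ ζ) (h0 ζ)) (norm_nonneg _ : 0 ≤ K ζ)
    simp only
    linarith
  rw [integral_add (i1.const_mul _) (i2.const_mul _),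
    integral_const_mul (klFun u - u * Real.log u) fun ζ => 1 * K ζ,
    integral_const_mul (Real.log u) fun ζ => ψ ζ * K ζ] at hle
  have := mul_le_mul_of_nonneg_left hle hδ.le
  refine le_trans (le_of_eq ?_) this
  rw [mul_add, mul_left_comm, ← e1, mul_left_comm, ← e2, ← hudef]
  ring

lemma continuousOn_poissonExtension {ψ : ℂ → ℝ} (hψ : Integrable ψ circleArc) :
    ContinuousOn (poissonExtension ψ) (Metric.ball 0 1) :=
  (continuousOn_const.mul (Complex.continuous_re.comp_continuousOn
    (differentiableOn_cauchyTransform hψ).continuousOn)).sub continuousOn_const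

lemma differentiableOn_deriv_cauchyTransform {ψ : ℂ → ℝ} (hψ : Integrable ψ circleArc) :
    DifferentiableOn ℂ (deriv (cauchyTransform ψ)) (Metric.ball 0 1) :=
  (differentiableOn_cauchyTransform hψ).deriv Metric.isOpen_ball

lemma circleIntegrable_of_continuousOn_ball {E : Type*} [NormedAddCommGroup E] {f : ℂ → E}
    (hf : ContinuousOn f (Metric.ball 0 1)) {t : ℝ} (ht : |t| < 1) : CircleIntegrable f 0 t :=
  (hf.mono fun z hz => by
    have : ‖z‖ = |t| := by simpa using hz
    simpa [this] using ht).circleIntegrable'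

lemma continuousOn_circleAverage_of_continuousOn_ball {f : ℂ → ℝ}
    (hf : ContinuousOn f (Metric.ball 0 1)) :
    ContinuousOn (Real.circleAverage f 0) (Set.Ico 0 1) := by
  refine Real.ContinuousOn.circleAverage (hf.mono fun z hz => ?_) fun r hr => hr.1
  have : ‖z - 0‖ < 1 := hz.2
  simpa using this

/-- The entropy of the Poisson extension on the circle of radius `t`. -/
noncomputable def circleEntropy (ψ : ℂ → ℝ) (t : ℝ) : ℝ :=
  Real.circleAverage (fun z => klFun (poissonExtension ψ z)) 0 t

/-- The average over the circle of radius `t` of `|∂u|² / u`, the Fisher information of the Poisson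
extension `u`; here `∂u` is the derivative of the Cauchy transform. -/
noncomputable def circleFisher (ψ : ℂ → ℝ) (t : ℝ) : ℝ :=
  Real.circleAverage
    (fun z => ‖deriv (cauchyTransform ψ) z‖ ^ 2 / poissonExtension ψ z) 0 t

lemma circleEntropy_nonneg {ψ : ℂ → ℝ} (hψ : Integrable ψ circleArc) (h0 : ∀ ζ, 0 < ψ ζ)
    {t : ℝ} (ht : |t| < 1) : 0 ≤ circleEntropy ψ t := by
  refine Real.circleAverage_nonneg_of_nonneg fun z hz => klFun_nonneg ?_
  have : ‖z‖ = |t| := by simpa using hz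
  exact (poissonExtension_pos hψ h0 (this ▸ ht)).le

lemma circleEntropy_le {ψ : ℂ → ℝ} (hψ : Integrable ψ circleArc) (h0 : ∀ ζ, 0 < ψ ζ)
    (hkl : Integrable (fun ζ => klFun (ψ ζ)) circleArc) {t : ℝ} (ht0 : 0 ≤ t) (ht : t < 1) :
    circleEntropy ψ t ≤ ∫ ζ, klFun (ψ ζ) ∂circleArc := by
  have ht' : |t| < 1 := by rwa [abs_of_nonneg ht0]
  rw [← circleAverage_poissonExtension hkl ht0 ht]
  refine Real.circleAverage_mono (circleIntegrable_of_continuousOn_ball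
    (continuous_klFun.comp_continuousOn (continuousOn_poissonExtension hψ)) ht')
    (circleIntegrable_of_continuousOn_ball (continuousOn_poissonExtension hkl) ht') fun z hz => ?_
  have : ‖z‖ = |t| := by simpa using hz
  exact klFun_poissonExtension_le hψ h0 hkl (this ▸ ht')

lemma continuousOn_fisherDensity {ψ : ℂ → ℝ} (hψ : Integrable ψ circleArc) (h0 : ∀ ζ, 0 < ψ ζ) :
    ContinuousOn (fun z => ‖deriv (cauchyTransform ψ) z‖ ^ 2 / poissonExtension ψ z)
      (Metric.ball 0 1) :=
  ((differentiableOn_deriv_cauchyTransform hψ).continuousOn.norm.pow 2).div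
    (continuousOn_poissonExtension hψ)
    fun z hz => (poissonExtension_pos hψ h0 (by simpa using hz)).ne'

lemma continuousOn_comp_circleMap {E : Type*} [TopologicalSpace E] {f : ℂ → E}
    (hf : ContinuousOn f (Metric.ball 0 1)) :
    ContinuousOn (fun p : ℝ × ℝ => f (circleMap 0 p.1 p.2)) (Set.Ioo (-1) 1 ×ˢ Set.univ) := by
  refine hf.comp (by unfold circleMap; fun_prop) fun p hp => ?_
  simpa [abs_lt] using hp.1

lemma hasDerivAt_circleMap_radius (t θ : ℝ) :
    HasDerivAt (fun t : ℝ => circleMap 0 t θ) (circleMap 0 1 θ) t := by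
  simp only [circleMap, zero_add, Complex.ofReal_one, one_mul]
  simpa using (Complex.ofRealCLM.hasDerivAt (x := t)).mul_const (Complex.exp (θ * Complex.I))

lemma hasDerivAt_poissonExtension_comp {ψ : ℂ → ℝ} (hψ : Integrable ψ circleArc) {γ : ℝ → ℂ}
    {γ' : ℂ} {t : ℝ} (hγ : HasDerivAt γ γ' t) (ht : ‖γ t‖ < 1) :
    HasDerivAt (fun t => poissonExtension ψ (γ t))
      (2 * (deriv (cauchyTransform ψ) (γ t) * γ').re) t := by
  have h := (hasDerivAt_cauchyTransform hψ ht).differentiableAt.hasDerivAt.scomp t hγ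
  rw [smul_eq_mul, mul_comm γ'] at h
  exact ((Complex.reCLM.hasFDerivAt.comp_hasDerivAt t h).const_mul 2).sub_const _

/-- The radial derivative of `circleEntropy`. -/
noncomputable def circleEntropyDeriv (ψ : ℂ → ℝ) (t : ℝ) : ℝ :=
  (2 * Real.pi)⁻¹ * ∫ θ in (0 : ℝ)..2 * Real.pi, Real.log (poissonExtension ψ (circleMap 0 t θ)) *
    (2 * (deriv (cauchyTransform ψ) (circleMap 0 t θ) * circleMap 0 1 θ).re)

lemma hasDerivAt_circleEntropy {ψ : ℂ → ℝ} (hψ : Integrable ψ circleArc) (h0 : ∀ ζ, 0 < ψ ζ)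
    {t : ℝ} (ht : t ∈ Set.Ioo (-1 : ℝ) 1) :
    HasDerivAt (circleEntropy ψ) (circleEntropyDeriv ψ t) t := by
  have hmem : ∀ s ∈ Set.Ioo (-1 : ℝ) 1, ∀ θ, ‖circleMap 0 s θ‖ < 1 := fun s hs θ => by
    simpa [abs_lt] using hs
  have hfun : circleEntropy ψ = fun t => (2 * Real.pi)⁻¹ * ∫ θ in (0 : ℝ)..2 * Real.pi,
      klFun (poissonExtension ψ (circleMap 0 t θ)) := by
    funext t
    rw [circleEntropy, Real.circleAverage_def, smul_eq_mul]
  rw [hfun]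
  refine (hasDerivAt_intervalIntegral_of_continuousOn
    (G := fun t θ => klFun (poissonExtension ψ (circleMap 0 t θ)))
    (G' := fun t θ => Real.log (poissonExtension ψ (circleMap 0 t θ)) *
      (2 * (deriv (cauchyTransform ψ) (circleMap 0 t θ) * circleMap 0 1 θ).re))
    isOpen_Ioo ?_ ?_ ?_ ht).const_mul (2 * Real.pi)⁻¹
  · intro s hs
    exact continuous_klFun.comp ((continuousOn_poissonExtension hψ).comp_continuous
      (continuous_circleMap 0 s) fun θ => by simpa using hmem s hs θ)
  · have h1 := continuousOn_comp_circleMap (continuousOn_poissonExtension hψ)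
    have h2 := continuousOn_comp_circleMap (differentiableOn_deriv_cauchyTransform hψ).continuousOn
    refine (h1.log fun p hp => (poissonExtension_pos hψ h0 (hmem _ hp.1 _)).ne').mul
      (continuousOn_const.mul (Complex.continuous_re.comp_continuousOn
        (h2.mul (Continuous.continuousOn (by unfold circleMap; fun_prop)))))
  · intro s hs θ
    have hu := poissonExtension_pos hψ h0 (hmem s hs θ)
    exact (hasDerivAt_klFun hu.ne').comp s (hasDerivAt_poissonExtension_comp hψ
      (hasDerivAt_circleMap_radius s θ) (hmem s hs θ))

/-- `d/dt (t T'(t)) = 4 t D(t)` with `T` the circle entropy and `D` the circle Fisher information.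
The term with the second derivative of the Cauchy transform is integrated by parts in the angle. -/
lemma hasDerivAt_mul_circleEntropyDeriv {ψ : ℂ → ℝ} (hψ : Integrable ψ circleArc)
    (h0 : ∀ ζ, 0 < ψ ζ)
    {t : ℝ} (ht : t ∈ Set.Ioo (-1 : ℝ) 1) :
    HasDerivAt (fun t => t * circleEntropyDeriv ψ t) (4 * t * circleFisher ψ t) t := by
  have hmem : ∀ s ∈ Set.Ioo (-1 : ℝ) 1, ∀ θ, ‖circleMap 0 s θ‖ < 1 := fun s hs θ => by
    simpa [abs_lt] using hs
  set f1 := deriv (cauchyTransform ψ) with hf1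
  set f2 := deriv f1 with hf2
  set u := poissonExtension ψ with hu
  have hd1 := differentiableOn_deriv_cauchyTransform hψ
  have hd2 : DifferentiableOn ℂ f2 (Metric.ball 0 1) := hd1.deriv Metric.isOpen_ball
  have hf1d : ∀ z, ‖z‖ < 1 → HasDerivAt f1 (f2 z) z := fun z hz =>
    (hd1.differentiableAt (Metric.isOpen_ball.mem_nhds (by simpa using hz))).hasDerivAt
  have hupos : ∀ s ∈ Set.Ioo (-1 : ℝ) 1, ∀ θ, 0 < u (circleMap 0 s θ) := fun s hs θ =>
    poissonExtension_pos hψ h0 (hmem s hs θ)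
  have c0 := continuousOn_comp_circleMap (continuousOn_poissonExtension hψ)
  have c1 := continuousOn_comp_circleMap hd1.continuousOn
  have c2 := continuousOn_comp_circleMap hd2.continuousOn
  have ce : Continuous fun p : ℝ × ℝ => circleMap 0 1 p.2 := by unfold circleMap; fun_prop
  have cz : Continuous fun p : ℝ × ℝ => circleMap 0 p.1 p.2 := by unfold circleMap; fun_prop
  have clog : ContinuousOn (fun p : ℝ × ℝ => Real.log (u (circleMap 0 p.1 p.2)))
      (Set.Ioo (-1) 1 ×ˢ Set.univ) := c0.log fun p hp => (hupos _ hp.1 _).ne'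
  have hslice : ∀ {g : ℝ × ℝ → ℝ}, ContinuousOn g (Set.Ioo (-1) 1 ×ˢ Set.univ) →
      ∀ s ∈ Set.Ioo (-1 : ℝ) 1, Continuous fun θ => g (s, θ) := fun hg s hs =>
    hg.comp_continuous (f := fun θ : ℝ => (s, θ)) (by fun_prop) fun θ => ⟨hs, trivial⟩
  -- the radial derivative of the integrand
  set A : ℝ → ℝ → ℝ := fun s θ => 2 * (f1 (circleMap 0 s θ) * circleMap 0 1 θ).re /
    u (circleMap 0 s θ) * (2 * (f1 (circleMap 0 s θ) * circleMap 0 s θ).re) with hA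
  set B : ℝ → ℝ → ℝ := fun s θ => Real.log (u (circleMap 0 s θ)) *
    (2 * (f2 (circleMap 0 s θ) * circleMap 0 1 θ * circleMap 0 s θ +
      f1 (circleMap 0 s θ) * circleMap 0 1 θ).re) with hB
  have cA : ContinuousOn (Function.uncurry A) (Set.Ioo (-1) 1 ×ˢ Set.univ) :=
    ((continuousOn_const.mul (Complex.continuous_re.comp_continuousOn
      (c1.mul ce.continuousOn))).div c0 fun p hp => (hupos _ hp.1 _).ne').mul
      (continuousOn_const.mul (Complex.continuous_re.comp_continuousOn (c1.mul cz.continuousOn)))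
  have cB : ContinuousOn (Function.uncurry B) (Set.Ioo (-1) 1 ×ˢ Set.univ) :=
    clog.mul (continuousOn_const.mul (Complex.continuous_re.comp_continuousOn
      (((c2.mul ce.continuousOn).mul cz.continuousOn).add (c1.mul ce.continuousOn))))
  have key := hasDerivAt_intervalIntegral_of_continuousOn (a := 0) (b := 2 * Real.pi)
    (G := fun s θ => Real.log (u (circleMap 0 s θ)) *
      (2 * (f1 (circleMap 0 s θ) * circleMap 0 s θ).re)) (G' := fun s θ => A s θ + B s θ)
    isOpen_Ioo
    (fun s hs => hslice (clog.mul (continuousOn_const.mul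
      (Complex.continuous_re.comp_continuousOn (c1.mul cz.continuousOn)))) s hs)
    (cA.add cB) (fun s hs θ => by
      have hz := hasDerivAt_circleMap_radius s θ
      have h1 := hasDerivAt_poissonExtension_comp hψ hz (hmem s hs θ)
      have h2 := h1.log (hupos s hs θ).ne'
      have h3 := ((hf1d _ (hmem s hs θ)).scomp s hz).mul hz
      have h4 := (Complex.reCLM.hasFDerivAt.comp_hasDerivAt s h3).const_mul 2
      refine (h2.mul h4).congr_deriv ?_
      simp only [hA, hB, smul_eq_mul, Function.comp, Complex.reCLM_apply]
      rw [mul_comm (circleMap 0 1 θ) (f2 _)]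
      rfl) ht
  -- integration by parts in the angle
  set H : ℝ → ℝ := fun θ => Real.log (u (circleMap 0 t θ)) *
    (2 * (f1 (circleMap 0 t θ) * circleMap 0 1 θ).im) with hH
  set A' : ℝ → ℝ := fun θ => 2 * (f1 (circleMap 0 t θ) * (circleMap 0 t θ * Complex.I)).re /
    u (circleMap 0 t θ) * (2 * (f1 (circleMap 0 t θ) * circleMap 0 1 θ).im) with hA'
  have cA' : Continuous A' := by
    refine hslice (g := fun p => 2 * (f1 (circleMap 0 p.1 p.2) *
      (circleMap 0 p.1 p.2 * Complex.I)).re / u (circleMap 0 p.1 p.2) *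
      (2 * (f1 (circleMap 0 p.1 p.2) * circleMap 0 1 p.2).im)) ?_ t ht
    exact ((continuousOn_const.mul (Complex.continuous_re.comp_continuousOn
      (c1.mul (cz.mul continuous_const).continuousOn))).div c0
        fun p hp => (hupos _ hp.1 _).ne').mul
      (continuousOn_const.mul (Complex.continuous_im.comp_continuousOn (c1.mul ce.continuousOn)))
  have cBt : Continuous (B t) := hslice cB t ht
  have cAt : Continuous (A t) := hslice cA t ht
  have hparts : ∫ θ in (0 : ℝ)..2 * Real.pi, (A' θ + B t θ) = 0 := by
    have hder : ∀ θ, HasDerivAt H (A' θ + B t θ) θ := fun θ => by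
      have hz := hasDerivAt_circleMap 0 t θ
      have he := hasDerivAt_circleMap 0 1 θ
      have h1 := hasDerivAt_poissonExtension_comp hψ hz (hmem t ht θ)
      have h2 := h1.log (hupos t ht θ).ne'
      have h3 := ((hf1d _ (hmem t ht θ)).scomp θ hz).mul he
      have h4 := (Complex.imCLM.hasFDerivAt.comp_hasDerivAt θ h3).const_mul 2
      refine (h2.mul h4).congr_deriv ?_
      simp only [hA', hB, smul_eq_mul, Function.comp, Complex.imCLM_apply]
      congr 3
      have : circleMap 0 t θ * Complex.I * f2 (circleMap 0 t θ) * circleMap 0 1 θ +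
          f1 (circleMap 0 t θ) * (circleMap 0 1 θ * Complex.I) =
          Complex.I * (f2 (circleMap 0 t θ) * circleMap 0 1 θ * circleMap 0 t θ +
            f1 (circleMap 0 t θ) * circleMap 0 1 θ) := by ring
      rw [this, Complex.I_mul_im]
    rw [intervalIntegral.integral_eq_sub_of_hasDerivAt (fun θ _ => hder θ)
      ((cA'.add cBt).intervalIntegrable _ _)]
    have p1 : circleMap 0 t (2 * Real.pi) = circleMap 0 t 0 := by
      simpa using periodic_circleMap 0 t 0
    have p2 : circleMap 0 1 (2 * Real.pi) = circleMap 0 1 0 := by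
      simpa using periodic_circleMap 0 1 0
    simp only [hH, p1, p2, sub_self]
  have hfun : (fun t => t * circleEntropyDeriv ψ t) = fun s => (2 * Real.pi)⁻¹ *
      ∫ θ in (0 : ℝ)..2 * Real.pi, Real.log (u (circleMap 0 s θ)) *
        (2 * (f1 (circleMap 0 s θ) * circleMap 0 s θ).re) := by
    funext s
    rw [circleEntropyDeriv, mul_left_comm, ← intervalIntegral.integral_const_mul]
    congr 1
    refine intervalIntegral.integral_congr fun θ _ => ?_
    have : circleMap 0 s θ = s * circleMap 0 1 θ := by simp [circleMap]
    simp only [← hf1, ← hu]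
    rw [show f1 (circleMap 0 s θ) * circleMap 0 s θ
      = s * (f1 (circleMap 0 s θ) * circleMap 0 1 θ) by rw [this]; ring, Complex.re_ofReal_mul]
    ring
  rw [hfun]
  refine (key.const_mul (2 * Real.pi)⁻¹).congr_deriv ?_
  rw [circleFisher, Real.circleAverage_def, smul_eq_mul, mul_left_comm]
  congr 1
  rw [← intervalIntegral.integral_const_mul]
  have hsplit : ∫ θ in (0 : ℝ)..2 * Real.pi, (A t θ + B t θ)
      = ∫ θ in (0 : ℝ)..2 * Real.pi, (A t θ - A' θ) + (A' θ + B t θ) :=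
    intervalIntegral.integral_congr fun θ _ => by ring
  have hadd := intervalIntegral.integral_add (f := fun θ => A t θ - A' θ)
    (g := fun θ => A' θ + B t θ) ((cAt.sub cA').intervalIntegrable (μ := volume) 0 (2 * Real.pi))
    ((cA'.add cBt).intervalIntegrable _ _)
  rw [hsplit, hadd, hparts, add_zero]
  refine intervalIntegral.integral_congr fun θ _ => ?_
  have hz : circleMap 0 t θ = t * circleMap 0 1 θ := by simp [circleMap]
  have hn : ‖f1 (circleMap 0 t θ)‖ ^ 2 = (f1 (circleMap 0 t θ) * circleMap 0 1 θ).re ^ 2 +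
      (f1 (circleMap 0 t θ) * circleMap 0 1 θ).im ^ 2 := by
    have : ‖f1 (circleMap 0 t θ) * circleMap 0 1 θ‖ ^ 2 = ‖f1 (circleMap 0 t θ)‖ ^ 2 := by
      rw [norm_mul]; simp
    rw [← this, Complex.sq_norm, Complex.normSq_apply]
    ring
  have e1 : f1 (circleMap 0 t θ) * circleMap 0 t θ
      = t * (f1 (circleMap 0 t θ) * circleMap 0 1 θ) := by rw [hz]; ring
  have e2 : f1 (circleMap 0 t θ) * (circleMap 0 t θ * Complex.I)
      = t * (Complex.I * (f1 (circleMap 0 t θ) * circleMap 0 1 θ)) := by rw [hz]; ring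
  simp only [← hf1, ← hu]
  simp only [hA, hA', e1, e2, hn, Complex.re_ofReal_mul, Complex.I_mul_re]
  have := (hupos t ht θ).ne'
  field_simp
  ring

/-- The Green-type inequality `∫_{|v|<r} (1 - |v|²) |∂u|² / u dA ≤ ∫_𝕋 klFun ψ ds`. -/
lemma integral_circleFisher_le {ψ : ℂ → ℝ} (hψ : Integrable ψ circleArc) (h0 : ∀ ζ, 0 < ψ ζ)
    (hkl : Integrable (fun ζ => klFun (ψ ζ)) circleArc)
    {r : ℝ} (hr0 : 0 ≤ r) (hr : r < 1) :
    ∫ t in (0 : ℝ)..r, 2 * t * ((1 - t ^ 2) * circleFisher ψ t) ≤ ∫ ζ, klFun (ψ ζ) ∂circleArc := by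
  set E := ∫ ζ, klFun (ψ ζ) ∂circleArc with hE
  -- `W c t` has derivative at least `(c - t²)(t T')'`, for every constant `c`
  set W : ℝ → ℝ → ℝ := fun c t =>
    (c - t ^ 2) * (t * circleEntropyDeriv ψ t) + 2 * t ^ 2 * circleEntropy ψ t with hW
  have hWd : ∀ c, ∀ t ∈ Set.Ioo (-1 : ℝ) 1, HasDerivAt (W c)
      ((c - t ^ 2) * (4 * t * circleFisher ψ t) + 4 * t * circleEntropy ψ t) t := by
    intro c t ht
    have h1 := (((hasDerivAt_pow 2 t).const_sub c).mul
      (hasDerivAt_mul_circleEntropyDeriv hψ h0 ht)).add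
      (((hasDerivAt_pow 2 t).const_mul 2).mul (hasDerivAt_circleEntropy hψ h0 ht))
    refine h1.congr_deriv ?_
    simp
    ring
  have hF0 : ∀ t, |t| < 1 → 0 ≤ circleFisher ψ t := fun t ht => by
    refine Real.circleAverage_nonneg_of_nonneg fun z hz => div_nonneg (sq_nonneg _) ?_
    have : ‖z‖ = |t| := by simpa using hz
    exact (poissonExtension_pos hψ h0 (this ▸ ht)).le
  have hsub : ∀ {R : ℝ}, R < 1 → Set.Icc 0 R ⊆ Set.Ioo (-1 : ℝ) 1 := fun hR t ht =>
    ⟨by linarith [ht.1], lt_of_le_of_lt ht.2 hR⟩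
  have hWr : W 1 r ≤ 2 * E := by
    -- monotonicity of `W (R²)` on `[r, R]`, then `R → 1`
    have hR : ∀ R ∈ Set.Ioo r 1, W (R ^ 2) r ≤ 2 * E := by
      intro R hR
      have hR0 : 0 < R := hr0.trans_lt hR.1
      have hsubr : Set.Icc r R ⊆ Set.Ioo (-1 : ℝ) 1 :=
        (Set.Icc_subset_Icc_left hr0).trans (hsub hR.2)
      have hmono : MonotoneOn (W (R ^ 2)) (Set.Icc r R) := by
        refine monotoneOn_of_deriv_nonneg (convex_Icc _ _)
          (fun t ht => (hWd _ t (hsubr ht)).continuousAt.continuousWithinAt)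
          (fun t ht =>
            (hWd _ t (hsubr (interior_subset ht))).differentiableAt.differentiableWithinAt)
          fun t ht => ?_
        have ht' := interior_subset ht
        rw [(hWd _ t (hsubr ht')).deriv]
        have ht0 : 0 ≤ t := hr0.trans ht'.1
        have ha : |t| < 1 := abs_lt.2 (hsubr ht')
        have h1 : 0 ≤ R ^ 2 - t ^ 2 := by nlinarith [ht'.2]
        have := hF0 t ha
        have := circleEntropy_nonneg hψ h0 ha
        positivity
      have h2 := hmono (Set.left_mem_Icc.2 hR.1.le) (Set.right_mem_Icc.2 hR.1.le) hR.1.le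
      refine h2.trans ?_
      have hle := circleEntropy_le hψ h0 hkl hR0.le hR.2
      have hnn := circleEntropy_nonneg hψ h0 (t := R) (abs_lt.2 ⟨by linarith, hR.2⟩)
      have hR2 : R ^ 2 ≤ 1 := by nlinarith [hR.2]
      simp only [hW, sub_self, zero_mul, zero_add]
      nlinarith
    have htend : Tendsto (fun R : ℝ => W (R ^ 2) r) (𝓝[<] 1) (𝓝 (W 1 r)) := by
      have : Continuous fun R : ℝ => W (R ^ 2) r := by simp only [hW]; fun_prop
      have h := this.tendsto 1
      simp only [one_pow] at h
      exact h.mono_left nhdsWithin_le_nhds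
    exact le_of_tendsto htend (Filter.eventually_of_mem (Ioo_mem_nhdsLT hr) hR)
  have hint : ∫ t in (0 : ℝ)..r, 2 * (2 * t * ((1 - t ^ 2) * circleFisher ψ t)) ≤
      W 1 r - W 1 0 := by
    refine intervalIntegral.integral_le_sub_of_hasDeriv_right_of_le hr0
      (fun t ht => (hWd _ t (hsub hr ht)).continuousAt.continuousWithinAt)
      (fun t ht => (hWd _ t (hsub hr (Set.Ioo_subset_Icc_self ht))).hasDerivWithinAt) ?_
      fun t ht => ?_
    · refine ContinuousOn.integrableOn_Icc ?_
      have := (continuousOn_circleAverage_of_continuousOn_ball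
        (continuousOn_fisherDensity hψ h0)).mono (Set.Icc_subset_Ico_right hr)
      change ContinuousOn (circleFisher ψ) _ at this
      fun_prop
    · have := circleEntropy_nonneg hψ h0 (t := t) (abs_lt.2 (hsub hr (Set.Ioo_subset_Icc_self ht)))
      have ht0 := ht.1
      have : 0 ≤ 4 * t * circleEntropy ψ t := by positivity
      linarith
  rw [intervalIntegral.integral_const_mul] at hint
  have hW0 : W 1 0 = 0 := by simp [hW]
  linarith

/-! ### Exponential moments of Bergman projections -/

/-- The dual estimate: `∫_{|v|<r} 2c|C + v C'| dA ≤ c² log(1/(1-r²)) + ∫ klFun ψ + 4 log 2` for a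
probability density `ψ` with Cauchy transform `C`, in polar coordinates. -/
lemma integral_circleAverage_norm_le {ψ : ℂ → ℝ} (hψ : Integrable ψ circleArc) (h0 : ∀ ζ, 0 < ψ ζ)
    (h1 : ∫ ζ, ψ ζ ∂circleArc = 1) (hkl : Integrable (fun ζ => klFun (ψ ζ)) circleArc)
    {r : ℝ} (hr0 : 0 ≤ r) (hr : r < 1) (c : ℝ) :
    2 * c * ∫ t in (0 : ℝ)..r, 2 * t * Real.circleAverage
        (fun z => ‖cauchyTransform ψ z + z * deriv (cauchyTransform ψ) z‖) 0 t ≤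
      c ^ 2 * Real.log (1 / (1 - r ^ 2)) + ∫ ζ, klFun (ψ ζ) ∂circleArc + 4 * Real.log 2 := by
  set k : ℂ → ℂ := fun z => cauchyTransform ψ z + z * deriv (cauchyTransform ψ) z with hk
  set u := poissonExtension ψ with hu
  have hkc : ContinuousOn (fun z => ‖k z‖) (Metric.ball 0 1) :=
    ((differentiableOn_cauchyTransform hψ).continuousOn.add
      (continuousOn_id.mul (differentiableOn_deriv_cauchyTransform hψ).continuousOn)).norm
  have huc : ContinuousOn u (Metric.ball 0 1) := continuousOn_poissonExtension hψ
  have hFc := continuousOn_fisherDensity hψ h0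
  have hI : ∀ t ∈ Set.Icc 0 r, 0 < 1 - t ^ 2 := fun t ht => by nlinarith [ht.1, ht.2]
  have hsub : Set.Icc 0 r ⊆ Set.Ico 0 1 := Set.Icc_subset_Ico_right hr
  have hd0 : ∀ t ∈ Set.Icc 0 r, √(1 - t ^ 2) * (1 + √(1 - t ^ 2)) ≠ 0 := fun t ht => by
    have := Real.sqrt_pos.2 (hI t ht)
    positivity
  have hpt : ∀ t ∈ Set.Icc 0 r, 2 * c * Real.circleAverage (fun z => ‖k z‖) 0 t ≤
      c ^ 2 / (1 - t ^ 2) + 2 / (√(1 - t ^ 2) * (1 + √(1 - t ^ 2)))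
        + (1 - t ^ 2) * circleFisher ψ t := by
    intro t ht
    have ht1 : t < 1 := (hsub ht).2
    have hta : |t| < 1 := by rwa [abs_of_nonneg ht.1]
    have hδ := hI t ht
    set δ := 1 - t ^ 2 with hδdef
    set q := √δ * (1 + √δ) with hq
    have hq0 : 0 < q := by have := Real.sqrt_pos.2 hδ; positivity
    have e1 : 2 * c * Real.circleAverage (fun z => ‖k z‖) 0 t
        = Real.circleAverage (fun z => (2 * c) • ‖k z‖) 0 t := by
      rw [Real.circleAverage_fun_smul, smul_eq_mul]
    have i1 := circleIntegrable_of_continuousOn_ball huc hta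
    have i2 := circleIntegrable_of_continuousOn_ball hFc hta
    have i1' : CircleIntegrable (fun z => (c ^ 2 / δ + 1 / q) • u z) 0 t := i1.const_smul
    have i2' : CircleIntegrable
        (fun z => δ • (‖deriv (cauchyTransform ψ) z‖ ^ 2 / poissonExtension ψ z)) 0 t :=
      i2.const_smul
    have i3 : CircleIntegrable (fun _ : ℂ => 1 / q) 0 t := circleIntegrable_const _ _ _
    have i12 : CircleIntegrable (fun z => (c ^ 2 / δ + 1 / q) • u z +
        δ • (‖deriv (cauchyTransform ψ) z‖ ^ 2 / poissonExtension ψ z)) 0 t := i1'.add i2'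
    have e2 : Real.circleAverage (fun z => ((c ^ 2 / δ + 1 / q) • u z +
        δ • (‖deriv (cauchyTransform ψ) z‖ ^ 2 / poissonExtension ψ z)) + 1 / q) 0 t
        = c ^ 2 / δ + 2 / q + δ * circleFisher ψ t := by
      rw [Real.circleAverage_fun_add i12 i3, Real.circleAverage_fun_add i1' i2',
        Real.circleAverage_fun_smul, Real.circleAverage_fun_smul, Real.circleAverage_const,
        circleAverage_poissonExtension hψ ht.1 ht1, h1, circleFisher]
      simp only [smul_eq_mul]
      ring
    rw [e1, ← e2]
    refine Real.circleAverage_mono ?_ (i12.add i3) fun z hz => ?_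
    · exact (circleIntegrable_of_continuousOn_ball hkc hta).const_smul
    · have hzt : ‖z‖ = t := by simpa [abs_of_nonneg ht.1] using hz
      have hz1 : ‖z‖ < 1 := hzt ▸ ht1
      have hup : 0 < u z := poissonExtension_pos hψ h0 hz1
      have hmain := norm_sq_div_poissonExtension_le hψ h0 h1 hz1
      rw [hzt, ← hδdef, ← hq] at hmain
      have hAM : 2 * c * ‖k z‖ ≤ c ^ 2 / δ * u z + δ * ‖k z‖ ^ 2 / u z := by
        have : c ^ 2 / δ * u z + δ * ‖k z‖ ^ 2 / u z - 2 * c * ‖k z‖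
            = (c * u z - δ * ‖k z‖) ^ 2 / (δ * u z) := by
          field_simp
          ring
        have h2 : 0 ≤ (c * u z - δ * ‖k z‖) ^ 2 / (δ * u z) := by positivity
        linarith
      simp only [smul_eq_mul]
      have e3 : (u z + 1) / q = 1 / q * u z + 1 / q := by ring
      change δ * ‖k z‖ ^ 2 / u z ≤ δ * (‖deriv (cauchyTransform ψ) z‖ ^ 2 / u z) + (u z + 1) / q
        at hmain
      rw [e3] at hmain
      rw [← hu]
      linarith
  -- an antiderivative of the two explicit terms
  set g : ℝ → ℝ := fun t => -(c ^ 2 * Real.log (1 - t ^ 2)) - 4 * Real.log (1 + √(1 - t ^ 2))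
    with hg
  have hgd : ∀ t ∈ Set.Icc 0 r, HasDerivAt g
      (2 * t * (c ^ 2 / (1 - t ^ 2) + 2 / (√(1 - t ^ 2) * (1 + √(1 - t ^ 2))))) t := by
    intro t ht
    have hδ := hI t ht
    have hs := Real.sqrt_pos.2 hδ
    have d1 : HasDerivAt (fun t : ℝ => 1 - t ^ 2) (-(2 * t)) t := by
      simpa using (hasDerivAt_pow 2 t).const_sub 1
    have d2 := ((d1.log hδ.ne').const_mul (c ^ 2)).neg
    have d3 := (((d1.sqrt hδ.ne').const_add 1).log (by positivity)).const_mul 4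
    refine (d2.sub d3).congr_deriv ?_
    field_simp
    ring
  have hexp : ContinuousOn (fun t : ℝ => 2 * t * (c ^ 2 / (1 - t ^ 2) +
      2 / (√(1 - t ^ 2) * (1 + √(1 - t ^ 2))))) (Set.Icc 0 r) := by
    refine ContinuousOn.mul (by fun_prop) (ContinuousOn.add ?_ ?_)
    · exact ContinuousOn.div (by fun_prop) (by fun_prop) fun t ht => (hI t ht).ne'
    · exact ContinuousOn.div (by fun_prop) (by fun_prop) hd0
  have hFis : ContinuousOn (fun t => 2 * t * ((1 - t ^ 2) * circleFisher ψ t)) (Set.Icc 0 r) := by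
    have : ContinuousOn (circleFisher ψ) (Set.Icc 0 r) :=
      (continuousOn_circleAverage_of_continuousOn_ball hFc).mono hsub
    fun_prop
  have hav : ContinuousOn (fun t => 2 * c * (2 * t * Real.circleAverage (fun z => ‖k z‖) 0 t))
      (Set.Icc 0 r) := by
    have := (continuousOn_circleAverage_of_continuousOn_ball hkc).mono hsub
    fun_prop
  rw [← Set.uIcc_of_le hr0] at hexp hFis hav hgd
  rw [← intervalIntegral.integral_const_mul]
  have hle : ∫ t in (0 : ℝ)..r, 2 * c * (2 * t * Real.circleAverage (fun z => ‖k z‖) 0 t) ≤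
      ∫ t in (0 : ℝ)..r, (2 * t * (c ^ 2 / (1 - t ^ 2) +
        2 / (√(1 - t ^ 2) * (1 + √(1 - t ^ 2)))) + 2 * t * ((1 - t ^ 2) * circleFisher ψ t)) := by
    refine intervalIntegral.integral_mono_on hr0 hav.intervalIntegrable
      (hexp.add hFis).intervalIntegrable fun t ht => ?_
    have := mul_le_mul_of_nonneg_left (hpt t ht) (by linarith [ht.1] : 0 ≤ 2 * t)
    linarith
  rw [intervalIntegral.integral_add hexp.intervalIntegrable hFis.intervalIntegrable,
    intervalIntegral.integral_eq_sub_of_hasDerivAt hgd hexp.intervalIntegrable] at hle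
  have hfish := integral_circleFisher_le hψ h0 hkl hr0 hr
  have hs : 0 ≤ Real.log (1 + √(1 - r ^ 2)) :=
    Real.log_nonneg (by linarith [Real.sqrt_nonneg (1 - r ^ 2)])
  have hg0 : g 0 = -(4 * Real.log 2) := by simp [hg, one_add_one_eq_two]
  have hgr : g r = c ^ 2 * Real.log (1 / (1 - r ^ 2)) - 4 * Real.log (1 + √(1 - r ^ 2)) := by
    rw [one_div, Real.log_inv]
    simp only [hg]
    ring
  rw [hg0, hgr] at hle
  linarith

/-- A function in the unit ball of `L^∞` may be replaced by a measurable function bounded by `1`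
everywhere without changing its Bergman projection. -/
lemma exists_measurable_bergmanProjection_eq {μ : ℂ → ℂ} (hμ : MemLp μ ∞ diskArea)
    (hμ1 : eLpNorm μ ∞ diskArea ≤ 1) :
    ∃ μ' : ℂ → ℂ, Measurable μ' ∧ (∀ z, ‖μ' z‖ ≤ 1) ∧
      bergmanProjection μ' = bergmanProjection μ := by
  have hm := hμ.1
  set ν := hm.mk μ with hν
  have hνm : Measurable ν := hm.stronglyMeasurable_mk.measurable
  have hae : ∀ᵐ z ∂diskArea, ‖μ z‖ ≤ 1 := by
    have h := ae_le_eLpNormEssSup (f := μ) (μ := diskArea)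
    rw [← eLpNorm_exponent_top] at h
    filter_upwards [h] with z hz
    have h2 := hz.trans hμ1
    rw [← ofReal_norm, ENNReal.ofReal_le_one] at h2
    exact h2
  refine ⟨{z | ‖ν z‖ ≤ 1}.indicator ν,
    hνm.indicator (measurableSet_le hνm.norm measurable_const), fun z => ?_, ?_⟩
  · by_cases h : z ∈ {z | ‖ν z‖ ≤ 1}
    · rw [Set.indicator_of_mem h]; exact h
    · rw [Set.indicator_of_notMem h, norm_zero]; exact zero_le_one
  · funext z
    refine integral_congr_ae ?_
    filter_upwards [hm.ae_eq_mk, hae] with w hw h1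
    rw [hw] at h1 ⊢
    rw [Set.indicator_of_mem (by exact h1)]

lemma norm_inv_bergmanKernel_le {r : ℝ} (hr0 : 0 ≤ r) (hr : r < 1) {ζ w : ℂ} (hζ : ‖ζ‖ = 1)
    (hw : ‖w‖ < 1) : ‖((1 - r * ζ * conj w) ^ 2)⁻¹‖ ≤ ((1 - r) ^ 2)⁻¹ := by
  have hle : ‖(r : ℂ) * w‖ ≤ r := by
    rw [norm_mul, Complex.norm_real, Real.norm_of_nonneg hr0]
    nlinarith
  have h := norm_inv_one_sub_sq_le hζ hle hr
  have e : ((1 - (r : ℂ) * ζ * conj w) ^ 2)⁻¹ = conj (((1 - conj ζ * (r * w)) ^ 2)⁻¹) := by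
    simp
    ring
  rwa [e, RCLike.norm_conj]

lemma measurable_bergmanProjection_dilate {μ : ℂ → ℂ} {r : ℝ} (hμ : Measurable μ) :
    Measurable fun ζ : ℂ => bergmanProjection μ (r * ζ) := by
  have : StronglyMeasurable (Function.uncurry fun (ζ w : ℂ) =>
      μ w / (1 - (r : ℂ) * ζ * conj w) ^ 2) :=
    Measurable.stronglyMeasurable (by unfold Function.uncurry; fun_prop)
  exact this.integral_prod_right.measurable

lemma norm_bergmanProjection_dilate_le {μ : ℂ → ℂ} {r : ℝ} (hμ1 : ∀ z, ‖μ z‖ ≤ 1)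
    (hr0 : 0 ≤ r) (hr : r < 1) {ζ : ℂ}
    (hζ : ‖ζ‖ = 1) :
    ‖bergmanProjection μ (r * ζ)‖ ≤ ((1 - r) ^ 2)⁻¹ * diskArea.real Set.univ := by
  refine norm_integral_le_of_norm_le_const ?_
  filter_upwards [ae_norm_lt_one_diskArea] with w hw
  rw [div_eq_mul_inv, norm_mul]
  calc ‖μ w‖ * ‖((1 - r * ζ * conj w) ^ 2)⁻¹‖ ≤ 1 * ((1 - r) ^ 2)⁻¹ :=
        mul_le_mul (hμ1 w) (norm_inv_bergmanKernel_le hr0 hr hζ hw) (norm_nonneg _) zero_le_one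
    _ = _ := one_mul _

/-- Duality: pairing `Pμ` with a density `ψ` on the circle of radius `r` is controlled by the area
integral of `|C + v C'|`, where `C` is the Cauchy transform of `ψ`. -/
lemma norm_integral_mul_bergmanProjection_le {μ : ℂ → ℂ} {r : ℝ} (hμ : Measurable μ)
    (hμ1 : ∀ z, ‖μ z‖ ≤ 1)
    (hr0 : 0 ≤ r) (hr : r < 1) {ψ : ℂ → ℝ} (hψ : Integrable ψ circleArc) :
    r ^ 2 * ‖∫ ζ, (ψ ζ : ℂ) * bergmanProjection μ (r * ζ) ∂circleArc‖ ≤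
      ∫ t in (0 : ℝ)..r, 2 * t * Real.circleAverage
        (fun z => ‖cauchyTransform ψ z + z * deriv (cauchyTransform ψ) z‖) 0 t := by
  set k : ℂ → ℂ := fun z => cauchyTransform ψ z + z * deriv (cauchyTransform ψ) z with hk
  have hkc : ContinuousOn (fun z => ‖k z‖) (Metric.ball 0 1) :=
    ((differentiableOn_cauchyTransform hψ).continuousOn.add
      (continuousOn_id.mul (differentiableOn_deriv_cauchyTransform hψ).continuousOn)).norm
  have hrz : ∀ z : ℂ, ‖z‖ < 1 → ‖(r : ℂ) * z‖ < 1 := fun z hz => by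
    rw [norm_mul, Complex.norm_real, Real.norm_of_nonneg hr0]
    nlinarith [norm_nonneg z]
  have hswap : ∫ ζ, (ψ ζ : ℂ) * bergmanProjection μ (r * ζ) ∂circleArc
      = ∫ w, μ w * conj (k (r * w)) ∂diskArea := by
    have hint : Integrable (Function.uncurry fun (ζ w : ℂ) =>
        (ψ ζ : ℂ) * (μ w / (1 - (r : ℂ) * ζ * conj w) ^ 2)) (circleArc.prod diskArea) := by
      have hψp : Integrable (fun p : ℂ × ℂ => (ψ p.1 : ℂ)) (circleArc.prod diskArea) :=
        Integrable.comp_fst (f := fun ζ => (ψ ζ : ℂ)) hψ.ofReal diskArea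
      refine Integrable.mul_bdd (c := ((1 - r) ^ 2)⁻¹) hψp
        (Measurable.aestronglyMeasurable (by fun_prop)) ?_
      filter_upwards [Measure.quasiMeasurePreserving_fst.ae ae_norm_eq_one_circleArc,
        Measure.quasiMeasurePreserving_snd.ae ae_norm_lt_one_diskArea] with p h1 h2
      rw [div_eq_mul_inv, norm_mul]
      calc ‖μ p.2‖ * ‖((1 - r * p.1 * conj p.2) ^ 2)⁻¹‖ ≤ 1 * ((1 - r) ^ 2)⁻¹ :=
            mul_le_mul (hμ1 _) (norm_inv_bergmanKernel_le hr0 hr h1 h2) (norm_nonneg _) zero_le_one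
        _ = _ := one_mul _
    simp_rw [bergmanProjection, ← integral_const_mul]
    rw [integral_integral_swap hint]
    refine integral_congr_ae ?_
    filter_upwards [ae_norm_lt_one_diskArea] with w hw
    rw [hk]
    simp only
    rw [cauchyTransform_add_mul_deriv hψ (hrz w hw), ← integral_conj, ← integral_const_mul]
    refine integral_congr_ae (ae_of_all _ fun ζ => ?_)
    simp
    ring
  have hcr : ContinuousOn (fun z : ℂ => ‖k (r * z)‖) (Metric.ball 0 1) :=
    hkc.comp (by fun_prop) fun z hz => by simpa using hrz z (by simpa using hz)
  have hbd : ∃ M, ∀ z : ℂ, ‖z‖ < 1 → ‖k (r * z)‖ ≤ M := by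
    obtain ⟨M, hM⟩ := (isCompact_closedBall (0 : ℂ) r).exists_bound_of_continuousOn
      (hkc.mono (Metric.closedBall_subset_ball hr))
    refine ⟨M, fun z hz => ?_⟩
    have := hM (r * z) (by
      rw [mem_closedBall_zero_iff, norm_mul, Complex.norm_real, Real.norm_of_nonneg hr0]
      nlinarith [norm_nonneg z])
    rwa [norm_norm] at this
  obtain ⟨M, hM⟩ := hbd
  have hac : AEStronglyMeasurable (fun z : ℂ => ‖k (r * z)‖) diskArea := by
    rw [diskArea]
    exact (hcr.aestronglyMeasurable measurableSet_ball).smul_measure _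
  have hki : Integrable (fun z : ℂ => ‖k (r * z)‖) diskArea := by
    refine Integrable.of_bound hac M ?_
    filter_upwards [ae_norm_lt_one_diskArea] with z hz
    rw [norm_norm]; exact hM z hz
  have hle : ‖∫ w, μ w * conj (k (r * w)) ∂diskArea‖ ≤ ∫ w, ‖k (r * w)‖ ∂diskArea := by
    refine norm_integral_le_of_norm_le hki (ae_of_all _ fun w => ?_)
    rw [norm_mul, RCLike.norm_conj]
    exact mul_le_of_le_one_left (norm_nonneg _) (hμ1 w)
  rw [hswap]
  refine (mul_le_mul_of_nonneg_left hle (sq_nonneg r)).trans (le_of_eq ?_)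
  rw [integral_diskArea hcr hki]
  have hscale : ∀ t : ℝ, Real.circleAverage (fun z : ℂ => ‖k (r * z)‖) 0 t
      = Real.circleAverage (fun z => ‖k z‖) 0 (r * t) := fun t => by
    simp only [Real.circleAverage_def, circleMap, zero_add, Complex.ofReal_mul, mul_assoc]
  have hcv := intervalIntegral.mul_integral_comp_mul_left
    (f := fun t => 2 * t * Real.circleAverage (fun z => ‖k z‖) 0 t) (a := 0) (b := 1) r
  rw [mul_zero, mul_one] at hcv
  rw [← hcv, pow_two, mul_assoc, ← intervalIntegral.integral_const_mul r]
  congr 1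
  refine intervalIntegral.integral_congr fun t _ => ?_
  simp only [hscale, smul_eq_mul]
  ring

/-- The sub-Gaussian bound for exponential moments of Bergman projections. By the Gibbs variational
identity, `log Z = ∫ φ ψ - ∫ klFun ψ` for `φ = 2 Re (ν r² g(r ·))` and `ψ = exp φ / Z`, and the
linear term is estimated by duality. -/
lemma lintegral_exp_re_bergmanProjection_le {μ : ℂ → ℂ} {r : ℝ} (hμ : Measurable μ)
    (hμ1 : ∀ z, ‖μ z‖ ≤ 1)
    (hr0 : 0 ≤ r) (hr : r < 1) (ν : ℂ) :
    ∫⁻ ζ, ENNReal.ofReal (Real.exp (2 * (ν * (r ^ 2 * bergmanProjection μ (r * ζ))).re))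
        ∂circleArc ≤
      ENNReal.ofReal (16 * Real.exp (‖ν‖ ^ 2 * Real.log (1 / (1 - r ^ 2)))) := by
  set φ : ℂ → ℝ := fun ζ => 2 * (ν * (r ^ 2 * bergmanProjection μ (r * ζ))).re with hφ
  have hgm := measurable_bergmanProjection_dilate (r := r) hμ
  have hφm : Measurable φ := by fun_prop
  set M := ((1 - r) ^ 2)⁻¹ * diskArea.real Set.univ with hMdef
  set K := 2 * (‖ν‖ * (r ^ 2 * M)) with hK
  have hφb : ∀ ζ, ‖ζ‖ = 1 → |φ ζ| ≤ K := by
    intro ζ hζ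
    have h1 := norm_bergmanProjection_dilate_le hμ1 hr0 hr hζ
    have h2 := Complex.abs_re_le_norm (ν * (r ^ 2 * bergmanProjection μ (r * ζ)))
    rw [norm_mul, norm_mul, norm_pow, Complex.norm_real, Real.norm_of_nonneg hr0] at h2
    rw [hφ, hK, abs_mul, abs_two]
    gcongr
    exact h2.trans (by gcongr)
  have hei : Integrable (fun ζ => Real.exp (φ ζ)) circleArc := by
    refine Integrable.of_bound (by fun_prop) (Real.exp K) ?_
    filter_upwards [ae_norm_eq_one_circleArc] with ζ hζ
    rw [Real.norm_of_nonneg (Real.exp_pos _).le]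
    exact Real.exp_le_exp.2 ((le_abs_self _).trans (hφb ζ hζ))
  set Z := ∫ ζ, Real.exp (φ ζ) ∂circleArc with hZ
  have hZ0 : 0 < Z := integral_exp_pos hei
  set ψ : ℂ → ℝ := fun ζ => Real.exp (φ ζ) / Z with hψdef
  have hψ0 : ∀ ζ, 0 < ψ ζ := fun ζ => div_pos (Real.exp_pos _) hZ0
  have hψi : Integrable ψ circleArc := hei.div_const Z
  have hψ1 : ∫ ζ, ψ ζ ∂circleArc = 1 := by
    rw [hψdef, integral_div, ← hZ, div_self hZ0.ne']
  have hψφ : Integrable (fun ζ => ψ ζ * φ ζ) circleArc := by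
    refine Integrable.mul_bdd (c := K) hψi hφm.aestronglyMeasurable ?_
    filter_upwards [ae_norm_eq_one_circleArc] with ζ hζ using hφb ζ hζ
  have hklf : (fun ζ => klFun (ψ ζ)) = fun ζ => ψ ζ * φ ζ - (Real.log Z + 1) * ψ ζ + 1 := by
    funext ζ
    have : Real.log (ψ ζ) = φ ζ - Real.log Z := by
      rw [hψdef]
      simp only
      rw [Real.log_div (Real.exp_pos _).ne' hZ0.ne', Real.log_exp]
    rw [klFun_apply, this]
    ring
  have hi2 : Integrable (fun ζ => ψ ζ * φ ζ - (Real.log Z + 1) * ψ ζ) circleArc :=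
    hψφ.sub (hψi.const_mul _)
  have hkl : Integrable (fun ζ => klFun (ψ ζ)) circleArc := by
    rw [hklf]; exact hi2.add (integrable_const 1)
  have hgibbs : ∫ ζ, klFun (ψ ζ) ∂circleArc = ∫ ζ, ψ ζ * φ ζ ∂circleArc - Real.log Z := by
    rw [hklf, integral_add hi2 (integrable_const 1), integral_sub hψφ (hψi.const_mul _),
      integral_const_mul, hψ1]
    simp
    ring
  have hgψ : Integrable (fun ζ => (ψ ζ : ℂ) * bergmanProjection μ (r * ζ)) circleArc :=
    integrable_mul_bounded_circleArc hψi hgm M fun ζ hζ =>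
      norm_bergmanProjection_dilate_le hμ1 hr0 hr hζ
  have hlin : ∫ ζ, ψ ζ * φ ζ ∂circleArc ≤
      2 * ‖ν‖ * (r ^ 2 * ‖∫ ζ, (ψ ζ : ℂ) * bergmanProjection μ (r * ζ) ∂circleArc‖) := by
    have e : ∫ ζ, ψ ζ * φ ζ ∂circleArc = (∫ ζ, 2 * ν * r ^ 2 *
        ((ψ ζ : ℂ) * bergmanProjection μ (r * ζ)) ∂circleArc).re := by
      have h := integral_re (hgψ.const_mul (2 * ν * r ^ 2))
      refine Eq.trans (integral_congr_ae (ae_of_all _ fun ζ => ?_)) h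
      change ψ ζ * (2 * (ν * (r ^ 2 * bergmanProjection μ (r * ζ))).re) =
        (2 * ν * r ^ 2 * ((ψ ζ : ℂ) * bergmanProjection μ (r * ζ))).re
      rw [show 2 * ν * r ^ 2 * ((ψ ζ : ℂ) * bergmanProjection μ (r * ζ)) = ((ψ ζ * 2 : ℝ) : ℂ) *
        (ν * (r ^ 2 * bergmanProjection μ (r * ζ))) by push_cast; ring, Complex.re_ofReal_mul]
      ring
    rw [e, integral_const_mul]
    refine (Complex.re_le_norm _).trans (le_of_eq ?_)
    simp only [norm_mul, norm_pow, Complex.norm_real, Real.norm_of_nonneg hr0, Complex.norm_ofNat]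
    ring
  have hdual := mul_le_mul_of_nonneg_left
    (norm_integral_mul_bergmanProjection_le hμ hμ1 hr0 hr hψi) (by positivity : 0 ≤ 2 * ‖ν‖)
  have hmain := integral_circleAverage_norm_le hψi hψ0 hψ1 hkl hr0 hr ‖ν‖
  have hlog : Real.log Z ≤ Real.log 16 + ‖ν‖ ^ 2 * Real.log (1 / (1 - r ^ 2)) := by
    have : Real.log 16 = 4 * Real.log 2 := by
      rw [show (16 : ℝ) = 2 ^ 4 by norm_num, Real.log_pow]; norm_num
    linarith
  rw [← ofReal_integral_eq_lintegral_ofReal hei (ae_of_all _ fun ζ => (Real.exp_pos _).le)]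
  refine ENNReal.ofReal_le_ofReal ?_
  have h16 : (16 : ℝ) = Real.exp (Real.log 16) := (Real.exp_log (by norm_num)).symm
  rw [h16, ← Real.exp_add, ← hZ, ← Real.exp_log hZ0]
  exact Real.exp_le_exp.2 hlog

/-! ### From exponential moments to the square-exponential bound -/

lemma integrable_exp_neg_norm_sq_add (α : ℂ) :
    Integrable fun z : ℂ => Real.exp (2 * (z * α).re - ‖z‖ ^ 2) := by
  have h := (GaussianFourier.integrable_cexp_neg_mul_sq_norm_add (b := 1) (by simp) 2 (conj α)).re
  refine h.congr (ae_of_all _ fun z => ?_)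
  have e : (-1 * (‖z‖ : ℂ) ^ 2 + 2 * ((inner ℝ (conj α) z : ℝ) : ℂ))
      = ((2 * (z * α).re - ‖z‖ ^ 2 : ℝ) : ℂ) := by
    simp [Complex.inner]
    ring
  simp only [e]
  rw [← Complex.ofReal_exp]
  exact Complex.ofReal_re _

/-- A Gaussian integral turns `exp |α|²` into a superposition of exponentials of real-linear
functions of `α`. -/
lemma integral_exp_neg_norm_sq_add (α : ℂ) :
    ∫ z : ℂ, Real.exp (2 * (z * α).re - ‖z‖ ^ 2) = Real.pi * Real.exp (‖α‖ ^ 2) := by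
  have h := GaussianFourier.integral_cexp_neg_mul_sq_norm_add (b := 1) (by simp) 2 (conj α)
  have e : ∀ z : ℂ, Complex.exp (-1 * (‖z‖ : ℂ) ^ 2 + 2 * ((inner ℝ (conj α) z : ℝ) : ℂ))
      = ((Real.exp (2 * (z * α).re - ‖z‖ ^ 2) : ℝ) : ℂ) := fun z => by
    rw [Complex.ofReal_exp]
    congr 1
    simp [Complex.inner]
    ring
  simp_rw [e] at h
  rw [integral_complex_ofReal, Complex.finrank_real_complex] at h
  apply Complex.ofReal_injective
  rw [h]
  simp
  congr 1
  ring

lemma lintegral_exp_sq_bergmanProjection_le_of_measurable {μ : ℂ → ℂ} (hμ : Measurable μ)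
    (hμ1 : ∀ z, ‖μ z‖ ≤ 1) {a : ℝ} (ha0 : 0 < a) (ha : a < 1) {r : ℝ} (hr0 : 0 < r) (hr : r < 1) :
    ∫⁻ ζ, ENNReal.ofReal (Real.exp (a * (r ^ 4 * ‖bergmanProjection μ (r * ζ)‖ ^ 2 /
        Real.log (1 / (1 - r ^ 2))))) ∂circleArc ≤ ENNReal.ofReal (16 / (1 - a)) := by
  set L := Real.log (1 / (1 - r ^ 2)) with hL
  have hL0 : 0 < L := Real.log_pos (by
    have : 0 < 1 - r ^ 2 := by nlinarith
    rw [lt_div_iff₀ this]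
    nlinarith [pow_pos hr0 2])
  set s := √(a / L) with hs
  have hs2 : s ^ 2 = a / L := Real.sq_sqrt (by positivity)
  have hs0 : 0 ≤ s := Real.sqrt_nonneg _
  have hgm := measurable_bergmanProjection_dilate (r := r) hμ
  set w : ℂ → ℂ := fun ζ => r ^ 2 * bergmanProjection μ (r * ζ) with hw
  have hwm : Measurable w := by fun_prop
  have hpi := Real.pi_pos
  have h1 : ∀ ζ, ENNReal.ofReal (Real.exp (a * (r ^ 4 * ‖bergmanProjection μ (r * ζ)‖ ^ 2 / L)))
      = ENNReal.ofReal Real.pi⁻¹ *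
        ∫⁻ z : ℂ, ENNReal.ofReal (Real.exp (2 * (z * (s * w ζ)).re - ‖z‖ ^ 2)) := by
    intro ζ
    have hn : ‖(s : ℂ) * w ζ‖ ^ 2 = a * (r ^ 4 * ‖bergmanProjection μ (r * ζ)‖ ^ 2 / L) := by
      rw [norm_mul, Complex.norm_real, Real.norm_of_nonneg hs0, mul_pow, hs2, hw]
      simp only [norm_mul, norm_pow, Complex.norm_real, Real.norm_of_nonneg hr0.le]
      ring
    rw [← ofReal_integral_eq_lintegral_ofReal (integrable_exp_neg_norm_sq_add _)
      (ae_of_all _ fun z => (Real.exp_pos _).le), integral_exp_neg_norm_sq_add, hn,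
      ← ENNReal.ofReal_mul (by positivity), inv_mul_cancel_left₀ hpi.ne']
  simp_rw [h1]
  rw [lintegral_const_mul' _ _ ENNReal.ofReal_ne_top, lintegral_lintegral_swap (by
    refine Measurable.aemeasurable ?_
    unfold Function.uncurry
    fun_prop)]
  have h2 : ∀ z : ℂ, ∫⁻ ζ, ENNReal.ofReal (Real.exp (2 * (z * (s * w ζ)).re - ‖z‖ ^ 2)) ∂circleArc
      ≤ ENNReal.ofReal (16 * Real.exp (-(1 - a) * ‖z‖ ^ 2)) := by
    intro z
    have e1 : ∀ ζ, ENNReal.ofReal (Real.exp (2 * (z * (s * w ζ)).re - ‖z‖ ^ 2)) =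
        ENNReal.ofReal (Real.exp (-‖z‖ ^ 2)) *
          ENNReal.ofReal (Real.exp (2 * (z * s * w ζ).re)) := fun ζ => by
      rw [← ENNReal.ofReal_mul (Real.exp_pos _).le, ← Real.exp_add, mul_assoc z]
      congr 2
      ring
    simp_rw [e1]
    rw [lintegral_const_mul' _ _ ENNReal.ofReal_ne_top]
    refine (mul_le_mul_right
      (lintegral_exp_re_bergmanProjection_le hμ hμ1 hr0.le hr (z * s)) _).trans
      (le_of_eq ?_)
    rw [← ENNReal.ofReal_mul (Real.exp_pos _).le, ← hL]
    congr 1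
    have : ‖z * (s : ℂ)‖ ^ 2 * L = a * ‖z‖ ^ 2 := by
      rw [norm_mul, Complex.norm_real, Real.norm_of_nonneg hs0, mul_pow, hs2]
      field_simp
    rw [this, mul_left_comm, ← Real.exp_add]
    congr 2
    ring
  refine (mul_le_mul_right (lintegral_mono h2) _).trans (le_of_eq ?_)
  have hg := GaussianFourier.integral_rexp_neg_mul_sq_norm (V := ℂ) (b := 1 - a) (by linarith)
  rw [Complex.finrank_real_complex] at hg
  have hgi : Integrable fun z : ℂ => Real.exp (-(1 - a) * ‖z‖ ^ 2) := by
    refine Integrable.of_integral_ne_zero ?_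
    rw [hg]
    have : 0 < Real.pi / (1 - a) := div_pos hpi (by linarith)
    positivity
  rw [← ofReal_integral_eq_lintegral_ofReal (hgi.const_mul 16)
    (ae_of_all _ fun z => by positivity), integral_const_mul, hg,
    ← ENNReal.ofReal_mul (by positivity)]
  congr 1
  have : (1 : ℝ) - a ≠ 0 := by linarith
  norm_num
  field_simp

/-- Passing from `16 / (1 - a)` to `10 (1 - a)^(-3/2)`. For `a ≥ 39/64` the former is smaller; for
smaller `a` Jensen's inequality compares with the exponent `39/64`, where both bounds are
`1024/25`. -/
lemma lintegral_exp_mul_le_of_forall {α : Type*} [MeasurableSpace α] {P : Measure α}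
    [IsProbabilityMeasure P] {Y : α → ℝ} (hY : Measurable Y)
    (h : ∀ a, 0 < a → a < 1 → ∫⁻ x, ENNReal.ofReal (Real.exp (a * Y x)) ∂P ≤
      ENNReal.ofReal (16 / (1 - a))) {a : ℝ} (ha0 : 0 < a) (ha : a < 1) :
    ∫⁻ x, ENNReal.ofReal (Real.exp (a * Y x)) ∂P ≤
      ENNReal.ofReal (10 * (1 - a) ^ (-(3 / 2) : ℝ)) := by
  have h1a : 0 < 1 - a := by linarith
  have hpow : (1 - a) ^ (-(3 / 2) : ℝ) = 1 / ((1 - a) * √(1 - a)) := by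
    rw [Real.rpow_neg h1a.le, show (3 / 2 : ℝ) = 1 + 1 / 2 by norm_num, Real.rpow_add h1a,
      Real.rpow_one, ← Real.sqrt_eq_rpow, one_div]
  rcases le_or_gt (39 / 64) a with hcase | hcase
  · refine (h a ha0 ha).trans (ENNReal.ofReal_le_ofReal ?_)
    have hs : √(1 - a) ≤ 5 / 8 := by
      rw [Real.sqrt_le_left (by norm_num)]
      linarith
    have hs0 : 0 < √(1 - a) := Real.sqrt_pos.2 h1a
    rw [hpow, mul_one_div, div_le_div_iff₀ h1a (by positivity)]
    nlinarith
  · have hm := h (39 / 64) (by norm_num) (by norm_num)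
    set q : ℝ := 39 / 64 / a with hq
    have hq1 : 1 ≤ q := by rw [hq, le_div_iff₀ ha0]; linarith
    have hq0 : 0 < q := by linarith
    -- Jensen's inequality in the form of comparison of `L^p` norms
    have hJ : ∫⁻ x, ENNReal.ofReal (Real.exp (a * Y x)) ∂P ≤
        (∫⁻ x, ENNReal.ofReal (Real.exp (39 / 64 * Y x)) ∂P) ^ (1 / q) := by
      have hmeas : AEStronglyMeasurable (fun x => ENNReal.ofReal (Real.exp (a * Y x))) P :=
        Measurable.aestronglyMeasurable (by fun_prop)
      have := eLpNorm'_le_eLpNorm'_of_exponent_le (μ := P) one_pos hq1 hmeas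
      rw [eLpNorm', eLpNorm'] at this
      simp only [enorm_eq_self, ENNReal.rpow_one, div_one] at this
      refine this.trans (le_of_eq ?_)
      congr 1
      refine lintegral_congr fun x => ?_
      rw [ENNReal.ofReal_rpow_of_pos (Real.exp_pos _), ← Real.exp_mul, hq]
      congr 2
      field_simp
    have hb : (16 : ℝ) / (1 - 39 / 64) = 1024 / 25 := by norm_num
    rw [hb] at hm
    refine hJ.trans ((ENNReal.rpow_le_rpow hm (by positivity)).trans ?_)
    rw [ENNReal.ofReal_rpow_of_pos (by norm_num)]
    refine ENNReal.ofReal_le_ofReal ?_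
    rw [← Real.log_le_log_iff (by positivity) (by positivity), Real.log_rpow (by norm_num),
      Real.log_mul (by norm_num) (by positivity), Real.log_rpow h1a]
    -- concavity of the logarithm: its tangent at `1 - 39/64 = 25/64`
    have htan : Real.log (1 - a) ≤ Real.log (25 / 64) + ((1 - a) / (25 / 64) - 1) := by
      have := Real.log_le_sub_one_of_pos (div_pos h1a (by norm_num : (0 : ℝ) < 25 / 64))
      rw [Real.log_div h1a.ne' (by norm_num)] at this
      linarith
    have hA : Real.log (1024 / 25) = Real.log 10 - 3 / 2 * Real.log (25 / 64) := by
      have e1 : (25 / 64 : ℝ) = (5 / 8) ^ 2 := by norm_num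
      have e2 : (1024 / 25 : ℝ) = 10 / (5 / 8) ^ 3 := by norm_num
      rw [e1, e2, Real.log_div (by norm_num) (by norm_num), Real.log_pow, Real.log_pow]
      push_cast
      ring
    have hlow : 117 / 50 ≤ Real.log (1024 / 25) := by
      rw [Real.le_log_iff_exp_le (by norm_num)]
      have h1 : Real.exp (117 / 50) ≤ Real.exp 1 ^ 3 := by
        rw [← Real.exp_nat_mul]
        exact Real.exp_le_exp.2 (by norm_num)
      have h2 : Real.exp 1 ^ 3 ≤ (2.7182818286 : ℝ) ^ 3 :=
        pow_le_pow_left₀ (Real.exp_pos 1).le Real.exp_one_lt_d9.le 3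
      exact h1.trans (h2.trans (by norm_num))
    have hqa : 1 / q = a / (39 / 64) := by rw [hq]; field_simp
    rw [hqa]
    nlinarith [mul_nonneg (sub_nonneg.2 hlow) (by linarith : 0 ≤ 39 / 64 - a)]

lemma lintegral_exp_sq_bergmanProjection_le {μ : ℂ → ℂ} (hμ : MemLp μ ∞ diskArea)
    (hμ1 : eLpNorm μ ∞ diskArea ≤ 1) {a : ℝ} (ha0 : 0 < a) (ha : a < 1) {r : ℝ} (hr0 : 0 < r)
    (hr : r < 1) :
    ∫⁻ ζ, ENNReal.ofReal (Real.exp (a * (r ^ 4 * ‖bergmanProjection μ (r * ζ)‖ ^ 2 /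
        Real.log (1 / (1 - r ^ 2))))) ∂circleArc ≤
      ENNReal.ofReal (10 * (1 - a) ^ (-(3 / 2) : ℝ)) := by
  obtain ⟨μ', hm, hb, he⟩ := exists_measurable_bergmanProjection_eq hμ hμ1
  rw [← he]
  have hgm := measurable_bergmanProjection_dilate (r := r) hm
  exact lintegral_exp_mul_le_of_forall (by fun_prop) (fun a ha0 ha =>
    lintegral_exp_sq_bergmanProjection_le_of_measurable hm hb ha0 ha hr0 hr) ha0 ha

/-! ### The extremal function -/

lemma measurable_mu0 : Measurable mu0 := by
  unfold mu0
  fun_prop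

lemma one_sub_ne_zero_of_norm_lt {z : ℂ} (hz : ‖z‖ < 1) : 1 - z ≠ 0 := by
  intro h
  rw [← sub_eq_zero.1 h, norm_one] at hz
  exact lt_irrefl _ hz

lemma norm_mu0 {z : ℂ} (hz : ‖z‖ < 1) : ‖mu0 z‖ = 1 := by
  have h : ‖1 - conj z‖ = ‖1 - z‖ := by rw [← RCLike.norm_conj (1 - z)]; simp
  rw [mu0, norm_div, h, div_self (norm_ne_zero_iff.2 (one_sub_ne_zero_of_norm_lt hz))]

lemma diskArea_ne_zero : diskArea ≠ 0 := by
  intro h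
  have h2 : diskArea (Metric.ball 0 1) = 0 := by simp [h]
  rw [diskArea, Measure.smul_apply, Measure.restrict_apply_self, smul_eq_mul, mul_eq_zero] at h2
  rcases h2 with h2 | h2
  · exact ENNReal.inv_ne_zero.2 ENNReal.ofReal_ne_top h2
  · exact (Metric.measure_ball_pos volume (0 : ℂ) one_pos).ne' h2

lemma ae_norm_mu0 : ∀ᵐ z ∂diskArea, ‖mu0 z‖ = 1 := by
  filter_upwards [ae_norm_lt_one_diskArea] with z hz using norm_mu0 hz

lemma memLp_mu0 : MemLp mu0 ∞ diskArea :=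
  memLp_top_of_bound measurable_mu0.aestronglyMeasurable 1 (ae_norm_mu0.mono fun _ h => h.le)

lemma eLpNorm_mu0 : eLpNorm mu0 ∞ diskArea = 1 := by
  have h : eLpNorm mu0 ∞ diskArea = eLpNorm (fun _ : ℂ => (1 : ℂ)) ∞ diskArea :=
    eLpNorm_congr_norm_ae (ae_norm_mu0.mono fun z h => by rw [h, norm_one])
  rw [h, eLpNorm_const _ (by simp) diskArea_ne_zero]
  simp

/-- The angular integral in `P μ₀`, by Cauchy's formula for the derivative: on `|w| = t` one has
`w̄ = t² / w`. -/
lemma circleAverage_mu0_kernel {z : ℂ} (hz : ‖z‖ < 1) {t : ℝ} (ht0 : 0 ≤ t) (ht : t < 1) :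
    Real.circleAverage (fun w => mu0 w / (1 - z * conj w) ^ 2) 0 t
      = (1 - t ^ 2) / (1 - z * t ^ 2) ^ 2 := by
  rcases ht0.eq_or_lt with rfl | ht0
  · simp [mu0]
  have ht2 : ‖z * (t : ℂ) ^ 2‖ < t := by
    rw [norm_mul, norm_pow, Complex.norm_real, Real.norm_of_nonneg ht0.le]
    nlinarith [norm_nonneg z]
  set h : ℂ → ℂ := fun w => (w - t ^ 2) / (1 - w) with hh
  have hd : ∀ w : ℂ, ‖w‖ < 1 → HasDerivAt h ((1 - t ^ 2) / (1 - w) ^ 2) w := by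
    intro w hw
    have hne := one_sub_ne_zero_of_norm_lt hw
    refine (((hasDerivAt_id w).sub_const _).div ((hasDerivAt_id w).const_sub 1) hne).congr_deriv ?_
    simp only [id]
    field_simp
    ring
  have hdo : DifferentiableOn ℂ h (Metric.ball 0 1) := fun w hw =>
    (hd w (by simpa using hw)).differentiableAt.differentiableWithinAt
  have hC := Complex.two_pi_I_inv_smul_circleIntegral_sub_sq_inv_smul_of_differentiable
    Metric.isOpen_ball (Metric.closedBall_subset_ball ht) hdo
    (show z * (t : ℂ) ^ 2 ∈ Metric.ball 0 t by simpa using ht2)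
  rw [(hd _ (ht2.trans ht)).deriv] at hC
  rw [Real.circleAverage_eq_circleIntegral ht0.ne', ← hC]
  congr 1
  refine circleIntegral.integral_congr ht0.le fun w hw => ?_
  have hwn : ‖w‖ = t := by simpa using hw
  have hw0 : w ≠ 0 := by rw [← norm_pos_iff, hwn]; exact ht0
  have hw1 := one_sub_ne_zero_of_norm_lt (hwn ▸ ht : ‖w‖ < 1)
  have hconj : conj w = t ^ 2 / w := by
    rw [eq_div_iff hw0, mul_comm, Complex.mul_conj, Complex.normSq_eq_norm_sq, hwn]
    push_cast; rfl
  have hne : w - z * t ^ 2 ≠ 0 := by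
    intro h0
    rw [← sub_eq_zero.1 h0, hwn] at ht2
    exact lt_irrefl _ ht2
  have hne2 : 1 - z * (t ^ 2 / w) ≠ 0 := by
    have : 1 - z * (t ^ 2 / w) = (w - z * t ^ 2) / w := by field_simp
    rw [this]
    exact div_ne_zero hne hw0
  simp only [hh, mu0, hconj, smul_eq_mul, sub_zero]
  field_simp

lemma sq_mul_bergmanProjection_mu0 {z : ℂ} (hz : ‖z‖ < 1) :
    z ^ 2 * bergmanProjection mu0 z = -Complex.log (1 - z) - z := by
  have hker : ∀ w : ℂ, ‖w‖ < 1 → 1 - z * conj w ≠ 0 := fun w hw =>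
    one_sub_ne_zero_of_norm_lt (by
      rw [norm_mul, RCLike.norm_conj]
      nlinarith [norm_nonneg z, norm_nonneg w])
  have hc : ContinuousOn (fun w => mu0 w / (1 - z * conj w) ^ 2) (Metric.ball 0 1) := by
    unfold mu0
    refine ContinuousOn.div (ContinuousOn.div (by fun_prop) (by fun_prop) fun w hw =>
      one_sub_ne_zero_of_norm_lt (by simpa using hw)) (by fun_prop) fun w hw =>
      pow_ne_zero 2 (hker w (by simpa using hw))
  have hi : Integrable (fun w => mu0 w / (1 - z * conj w) ^ 2) diskArea := by
    have hm := measurable_mu0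
    refine Integrable.of_bound (Measurable.aestronglyMeasurable (by fun_prop))
      (1 / (1 - ‖z‖) ^ 2) ?_
    filter_upwards [ae_norm_lt_one_diskArea] with w hw
    rw [norm_div, norm_mu0 hw, norm_pow]
    have h1 : 1 - ‖z‖ ≤ ‖1 - z * conj w‖ := by
      have := norm_sub_norm_le (1 : ℂ) (z * conj w)
      rw [norm_one, norm_mul, RCLike.norm_conj] at this
      nlinarith [norm_nonneg z, norm_nonneg w]
    exact one_div_le_one_div_of_le (pow_pos (by linarith) 2)
      (pow_le_pow_left₀ (by linarith) h1 2)
  have hzt : ∀ t ∈ Set.Icc (0 : ℝ) 1, ‖z * (t : ℂ) ^ 2‖ < 1 := fun t ht => by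
    rw [norm_mul, norm_pow, Complex.norm_real, Real.norm_of_nonneg ht.1]
    nlinarith [norm_nonneg z, mul_nonneg (norm_nonneg z) (sq_nonneg t), ht.1, ht.2,
      pow_le_one₀ (n := 2) ht.1 ht.2]
  have hcI : ContinuousOn (fun t : ℝ => z ^ 2 * ((2 * t : ℂ) * ((1 - (t : ℂ) ^ 2) /
      (1 - z * (t : ℂ) ^ 2) ^ 2))) (Set.uIcc 0 1) := by
    rw [Set.uIcc_of_le zero_le_one]
    refine continuousOn_const.mul (ContinuousOn.mul (by fun_prop)
      (ContinuousOn.div (by fun_prop) (by fun_prop) fun t ht =>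
        pow_ne_zero 2 (one_sub_ne_zero_of_norm_lt (hzt t ht))))
  have hpolar : bergmanProjection mu0 z = ∫ t in (0 : ℝ)..1,
      (2 * t : ℂ) * ((1 - (t : ℂ) ^ 2) / (1 - z * (t : ℂ) ^ 2) ^ 2) := by
    rw [bergmanProjection, integral_diskArea hc hi]
    rw [intervalIntegral.integral_of_le zero_le_one, intervalIntegral.integral_of_le zero_le_one,
      integral_Ioc_eq_integral_Ioo, integral_Ioc_eq_integral_Ioo]
    refine setIntegral_congr_fun measurableSet_Ioo fun t ht => ?_
    simp only [circleAverage_mu0_kernel hz ht.1.le ht.2, Complex.real_smul]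
    push_cast
    ring
  rw [hpolar, ← intervalIntegral.integral_const_mul]
  rw [intervalIntegral.integral_eq_sub_of_hasDerivAt
    (f := fun t : ℝ => (z - 1) / (1 - z * (t : ℂ) ^ 2) - Complex.log (1 - z * (t : ℂ) ^ 2)) ?_
    hcI.intervalIntegrable]
  · simp
    have := one_sub_ne_zero_of_norm_lt hz
    have e : (z - 1) / (1 - z) = -1 := by field_simp; ring
    rw [e]
    ring
  · intro t ht
    rw [Set.uIcc_of_le zero_le_one] at ht
    have hn := hzt t ht
    have hne := one_sub_ne_zero_of_norm_lt hn
    have hsl : 1 - z * (t : ℂ) ^ 2 ∈ Complex.slitPlane := by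
      left
      have := Complex.re_le_norm (z * (t : ℂ) ^ 2)
      simp only [Complex.sub_re, Complex.one_re]
      linarith
    have d1 : HasDerivAt (fun t : ℝ => 1 - z * (t : ℂ) ^ 2) (-(z * (2 * t))) t := by
      have h := (((Complex.ofRealCLM.hasDerivAt (x := t)).pow 2).const_mul z).const_sub 1
      simpa using h
    refine (((hasDerivAt_const t (z - 1)).div d1 hne).sub (d1.clog_real hsl)).congr_deriv ?_
    field_simp
    ring

lemma log_sub_two_le_sq_mul_norm_bergmanProjection_mu0 {r θ : ℝ} (hr0 : 0 < r) (hr : r < 1)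
    (hθ0 : 0 ≤ θ) (hθ : θ ≤ 1 - r) :
    Real.log (1 / (1 - r)) - 2 ≤ r ^ 2 * ‖bergmanProjection mu0 (r * circleMap 0 1 θ)‖ := by
  set ζ := circleMap 0 1 θ with hζ
  have hζn : ‖ζ‖ = 1 := by simp [hζ]
  have hz : ‖(r : ℂ) * ζ‖ = r := by
    rw [norm_mul, hζn, Complex.norm_real, Real.norm_of_nonneg hr0.le, mul_one]
  have hz1 : ‖(r : ℂ) * ζ‖ < 1 := hz.trans_lt hr
  have he : ‖ζ - 1‖ ≤ θ := by
    have := Real.norm_exp_I_mul_ofReal_sub_one_le (x := θ)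
    rw [Real.norm_of_nonneg hθ0] at this
    simpa [hζ, circleMap, mul_comm] using this
  have hdist : ‖1 - (r : ℂ) * ζ‖ ≤ 2 * (1 - r) := by
    have e : 1 - (r : ℂ) * ζ = ((1 - r : ℝ) : ℂ) - r * (ζ - 1) := by push_cast; ring
    rw [e]
    refine (norm_sub_le _ _).trans ?_
    rw [norm_mul, Complex.norm_real, Complex.norm_real, Real.norm_of_nonneg hr0.le,
      Real.norm_of_nonneg (by linarith)]
    nlinarith [norm_nonneg (ζ - 1)]
  have hpos : 0 < ‖1 - (r : ℂ) * ζ‖ := norm_pos_iff.2 (one_sub_ne_zero_of_norm_lt hz1)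
  have hlog : Real.log ‖1 - (r : ℂ) * ζ‖ ≤ 1 - Real.log (1 / (1 - r)) := by
    have h1 := Real.log_le_log hpos hdist
    rw [Real.log_mul (by norm_num) (by linarith)] at h1
    have h2 := Real.log_two_lt_d9
    rw [one_div, Real.log_inv]
    linarith
  have h1 : r ^ 2 * ‖bergmanProjection mu0 (r * ζ)‖ = ‖-Complex.log (1 - r * ζ) - r * ζ‖ := by
    rw [← sq_mul_bergmanProjection_mu0 hz1, norm_mul, norm_pow, hz]
  rw [h1]
  have h2 := norm_sub_norm_le (-Complex.log (1 - r * ζ)) ((r : ℂ) * ζ)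
  have h3 := (neg_le_abs _).trans (Complex.abs_re_le_norm (Complex.log (1 - r * ζ)))
  rw [Complex.log_re] at h3
  rw [norm_neg, hz] at h2
  linarith

/-- An arc of length `1 - r` with endpoint `1` already contributes `(1 - r)^(1 - a)` up to a
constant. -/
lemma le_lintegral_exp_sq_bergmanProjection_mu0 {a : ℝ} (ha : 1 < a) {r : ℝ} (hr0 : 0 < r)
    (hr : r < 1) (hlog : 2 ≤ Real.log (1 / (1 - r))) :
    ENNReal.ofReal ((2 * Real.pi)⁻¹ * Real.exp ((a - 1) * Real.log (1 / (1 - r)) - 4 * a)) ≤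
      ∫⁻ ζ, ENNReal.ofReal (Real.exp (a * (r ^ 4 * ‖bergmanProjection mu0 (r * ζ)‖ ^ 2 /
        Real.log (1 / (1 - r ^ 2))))) ∂circleArc := by
  have hm := measurable_bergmanProjection_dilate (r := r) measurable_mu0
  have hε : 0 < 1 - r := by linarith
  set ℓ := Real.log (1 / (1 - r)) with hℓ
  set L := Real.log (1 / (1 - r ^ 2)) with hL
  have hr2 : 0 < 1 - r ^ 2 := by nlinarith
  have hL0 : 0 < L := Real.log_pos (by
    rw [lt_div_iff₀ hr2]
    nlinarith [pow_pos hr0 2])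
  have hLℓ : L ≤ ℓ := by
    refine Real.log_le_log (by positivity) ?_
    exact one_div_le_one_div_of_le hε (by nlinarith)
  rw [lintegral_circleArc (by fun_prop)]
  have hsub : Set.Ioc 0 (1 - r) ⊆ Set.Ioc 0 (2 * Real.pi) :=
    Set.Ioc_subset_Ioc_right (by linarith [Real.pi_gt_three])
  have hlow : ∀ θ ∈ Set.Ioc 0 (1 - r), ENNReal.ofReal (Real.exp (a * (ℓ - 4))) ≤
      ENNReal.ofReal (Real.exp
        (a * (r ^ 4 * ‖bergmanProjection mu0 (r * circleMap 0 1 θ)‖ ^ 2 / L))) := by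
    intro θ hθ
    refine ENNReal.ofReal_le_ofReal (Real.exp_le_exp.2 (mul_le_mul_of_nonneg_left ?_ (by linarith)))
    have h := log_sub_two_le_sq_mul_norm_bergmanProjection_mu0 hr0 hr hθ.1.le hθ.2
    rw [← hℓ] at h
    have h2 := pow_le_pow_left₀ (by linarith) h 2
    rw [le_div_iff₀ hL0]
    have h3 : (ℓ - 4) * L ≤ (ℓ - 2) ^ 2 := by
      rcases le_or_gt ℓ 4 with h4 | h4
      · exact (mul_nonpos_of_nonpos_of_nonneg (by linarith) hL0.le).trans (sq_nonneg _)
      · nlinarith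
    refine h3.trans (h2.trans (le_of_eq ?_))
    ring
  have hint : ENNReal.ofReal (Real.exp (a * (ℓ - 4))) * ENNReal.ofReal (1 - r) ≤
      ∫⁻ θ in Set.Ioc 0 (2 * Real.pi), ENNReal.ofReal (Real.exp (a * (r ^ 4 *
        ‖bergmanProjection mu0 (r * circleMap 0 1 θ)‖ ^ 2 / L))) := by
    refine le_trans ?_ (lintegral_mono_set hsub)
    refine le_trans (le_of_eq ?_) (setLIntegral_mono' measurableSet_Ioc hlow)
    rw [setLIntegral_const, Real.volume_Ioc, sub_zero]
  refine le_trans (le_of_eq ?_) (mul_le_mul_right hint _)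
  rw [← ENNReal.ofReal_inv_of_pos Real.two_pi_pos, ← ENNReal.ofReal_mul (Real.exp_pos _).le,
    ← ENNReal.ofReal_mul (by positivity)]
  have h1 : 1 - r = Real.exp (-ℓ) := by
    rw [hℓ, one_div, Real.log_inv, neg_neg, Real.exp_log hε]
  rw [h1]
  rw [← Real.exp_add]
  congr 3
  ring

lemma tendsto_log_one_div_one_sub :
    Tendsto (fun r : ℝ => Real.log (1 / (1 - r))) (𝓝[<] 1) atTop := by
  simp only [one_div]
  refine Real.tendsto_log_atTop.comp (tendsto_inv_nhdsGT_zero.comp ?_)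
  refine tendsto_nhdsWithin_of_tendsto_nhds_of_eventually_within _ ?_ ?_
  · have : Continuous fun r : ℝ => 1 - r := by fun_prop
    have h := (this.tendsto 1).mono_left (nhdsWithin_le_nhds (s := Set.Iio 1))
    rwa [sub_self] at h
  · filter_upwards [self_mem_nhdsWithin] with r hr
    simpa using hr

lemma tendsto_lintegral_exp_sq_bergmanProjection_mu0 {a : ℝ} (ha : 1 < a) :
    Tendsto (fun r : ℝ =>
      ∫⁻ ζ, ENNReal.ofReal (Real.exp (a * (r ^ 4 * ‖bergmanProjection mu0 (r * ζ)‖ ^ 2 /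
        Real.log (1 / (1 - r ^ 2))))) ∂circleArc) (𝓝[<] 1) (𝓝 ∞) := by
  have hlog := tendsto_log_one_div_one_sub
  have hlim : Tendsto (fun r : ℝ => ENNReal.ofReal ((2 * Real.pi)⁻¹ *
      Real.exp ((a - 1) * Real.log (1 / (1 - r)) - 4 * a))) (𝓝[<] 1) (𝓝 ∞) := by
    refine ENNReal.tendsto_ofReal_nhds_top.2 (Tendsto.const_mul_atTop (by positivity)
      (Real.tendsto_exp_atTop.comp ?_))
    exact tendsto_atTop_add_const_right _ _ (hlog.const_mul_atTop (by linarith))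
  refine tendsto_nhds_top_mono hlim ?_
  filter_upwards [hlog.eventually_ge_atTop 2, Ioo_mem_nhdsLT zero_lt_one] with r h2 hr
  exact le_lintegral_exp_sq_bergmanProjection_mu0 ha hr.1 hr.2 h2

/-! ### The asymptotic tail variances -/

lemma mu0_mem_ballPLinfty : bergmanProjection mu0 ∈ ballPLinfty :=
  ⟨mu0, ⟨memLp_mu0, eLpNorm_mu0.le⟩, rfl⟩

lemma log_one_div_one_sub_sq_nonneg {r : ℝ} (hr : r ∈ Set.Ioo (0 : ℝ) 1) :
    0 ≤ Real.log (1 / (1 - r ^ 2)) := by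
  have h1 : 0 < 1 - r ^ 2 := by nlinarith [hr.1, hr.2]
  exact Real.log_nonneg (by rw [le_div_iff₀ h1]; nlinarith [sq_nonneg r])

lemma atvarFamily_le_atvarUnif (G : Set (ℂ → ℂ)) : atvarFamily G ≤ atvarUnif G := by
  refine iSup₂_le fun g hg => sInf_le_sInf (Set.image_mono ?_)
  rintro τ ⟨hτ, hlim⟩
  refine ⟨hτ, lt_of_le_of_lt (limsup_le_limsup (Eventually.of_forall fun r => ?_)) hlim⟩
  exact le_iSup₂ (f := fun g (_ : g ∈ G) => expMean g τ r) g hg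

lemma atvarUnif_ballPLinfty_le_one : atvarUnif ballPLinfty ≤ 1 := by
  refine le_of_forall_gt fun c hc => ?_
  obtain ⟨τ, hτ0, h1τ, hτc⟩ := ENNReal.lt_iff_exists_real_btwn.1 hc
  have hτ : 1 < τ := ENNReal.one_lt_ofReal.1 h1τ
  refine lt_of_le_of_lt (sInf_le ⟨τ, ⟨by linarith, ?_⟩, rfl⟩) hτc
  obtain ⟨a, ha1, ha2⟩ := exists_between (inv_lt_one_of_one_lt₀ hτ)
  have ha0 : 0 < a := (inv_pos.2 (by linarith)).trans ha1
  -- `1/τ < a r⁴` for `r` close to `1`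
  have hev : ∀ᶠ r : ℝ in 𝓝[<] 1, τ⁻¹ < a * r ^ 4 := by
    have hc : Continuous fun r : ℝ => a * r ^ 4 := by fun_prop
    have h := (hc.tendsto 1).mono_left (nhdsWithin_le_nhds (s := Set.Iio 1))
    rw [one_pow, mul_one] at h
    exact h.eventually_const_lt ha1
  refine lt_of_le_of_lt (limsup_le_of_le
    (a := ENNReal.ofReal (10 * (1 - a) ^ (-(3 / 2) : ℝ))) ?_ ?_) ENNReal.ofReal_lt_top
  · exact isCobounded_le_of_bot
  filter_upwards [hev, Ioo_mem_nhdsLT zero_lt_one] with r hr hr1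
  refine iSup₂_le ?_
  rintro g ⟨μ, ⟨hμ, hμ1⟩, rfl⟩
  refine le_trans (lintegral_mono fun ζ => ENNReal.ofReal_le_ofReal (Real.exp_le_exp.2 ?_))
    (lintegral_exp_sq_bergmanProjection_le hμ hμ1 ha0 ha2 hr1.1 hr1.2)
  have hL := log_one_div_one_sub_sq_nonneg hr1
  set X := ‖bergmanProjection μ (r * ζ)‖ ^ 2
  set L := Real.log (1 / (1 - r ^ 2))
  have hX : 0 ≤ X / L := div_nonneg (sq_nonneg _) hL
  calc X / (τ * L) = τ⁻¹ * (X / L) := by rw [div_mul_eq_div_div_swap, div_eq_inv_mul]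
    _ ≤ a * r ^ 4 * (X / L) := mul_le_mul_of_nonneg_right hr.le hX
    _ = a * (r ^ 4 * X / L) := by ring

lemma one_le_atvar_bergmanProjection_mu0 : 1 ≤ atvar (bergmanProjection mu0) := by
  refine le_sInf ?_
  rintro _ ⟨τ, ⟨hτ0, hlim⟩, rfl⟩
  by_contra hcon
  have hτ : τ < 1 := ENNReal.ofReal_lt_one.1 (not_le.1 hcon)
  have ht := tendsto_lintegral_exp_sq_bergmanProjection_mu0 (one_lt_inv_iff₀.2 ⟨hτ0, hτ⟩)
  have ht2 : Tendsto (fun r : ℝ => expMean (bergmanProjection mu0) τ r) (𝓝[<] 1) (𝓝 ∞) := by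
    refine tendsto_nhds_top_mono ht ?_
    filter_upwards [Ioo_mem_nhdsLT zero_lt_one] with r hr
    refine lintegral_mono fun ζ => ENNReal.ofReal_le_ofReal (Real.exp_le_exp.2 ?_)
    have hL := log_one_div_one_sub_sq_nonneg hr
    set X := ‖bergmanProjection mu0 (r * ζ)‖ ^ 2
    set L := Real.log (1 / (1 - r ^ 2))
    have hX : 0 ≤ X / L := div_nonneg (sq_nonneg _) hL
    have hr4 : r ^ 4 ≤ 1 := pow_le_one₀ hr.1.le hr.2.le
    calc τ⁻¹ * (r ^ 4 * X / L) = r ^ 4 * (τ⁻¹ * (X / L)) := by ring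
      _ ≤ 1 * (τ⁻¹ * (X / L)) :=
        mul_le_mul_of_nonneg_right hr4 (mul_nonneg (inv_pos.2 hτ0).le hX)
      _ = X / (τ * L) := by rw [one_mul, div_mul_eq_div_div_swap, div_eq_inv_mul (X / L)]
  rw [ht2.limsup_eq] at hlim
  exact lt_irrefl _ hlim

theorem theorem1p1 :
    (∀ μ : ℂ → ℂ, MemLp μ ∞ diskArea → eLpNorm μ ∞ diskArea ≤ 1 →
      ∀ a : ℝ, 0 < a → a < 1 → ∀ r : ℝ, 0 < r → r < 1 →
        ∫⁻ ζ, ENNReal.ofReal (Real.exp (a * (r ^ 4 * ‖bergmanProjection μ (r * ζ)‖ ^ 2 /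
            Real.log (1 / (1 - r ^ 2))))) ∂circleArc
          ≤ ENNReal.ofReal (10 * (1 - a) ^ (-(3 / 2) : ℝ))) ∧
    (MemLp mu0 ∞ diskArea ∧ eLpNorm mu0 ∞ diskArea = 1 ∧
      ∀ a : ℝ, 1 < a →
        Tendsto (fun r : ℝ =>
          ∫⁻ ζ, ENNReal.ofReal (Real.exp (a * (r ^ 4 * ‖bergmanProjection mu0 (r * ζ)‖ ^ 2 /
            Real.log (1 / (1 - r ^ 2))))) ∂circleArc) (𝓝[<] 1) (𝓝 ∞)) ∧
    atvarUnif ballPLinfty = 1 ∧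
    atvarFamily ballPLinfty = 1 := by

  have h1 : 1 ≤ atvarFamily ballPLinfty := one_le_atvar_bergmanProjection_mu0.trans
    (le_iSup₂ (f := fun g (_ : g ∈ ballPLinfty) => atvar g) _ mu0_mem_ballPLinfty)
  have h2 := atvarFamily_le_atvarUnif ballPLinfty
  have h3 := atvarUnif_ballPLinfty_le_one
  exact ⟨fun μ hμ hμ1 a ha0 ha r hr0 hr =>
      lintegral_exp_sq_bergmanProjection_le hμ hμ1 ha0 ha hr0 hr,
    ⟨memLp_mu0, eLpNorm_mu0, fun a ha => tendsto_lintegral_exp_sq_bergmanProjection_mu0 ha⟩,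
    le_antisymm h3 (h1.trans h2), le_antisymm (h2.trans h3) h1⟩
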